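/- **Corollary 2 (Newton's Lemma).** Let $B,\bar B$ be Banach spaces over $\mathbb K\in\{\mathbb R,\mathbb C\}$, let $k\ge 1$ and $1\le m\le\infty$, and let $G\in C^{m+2k}(B,\bar B)$ and $z\in C^{m+2k}(U,B)$, with $U\subset\mathbb K$ an open neighbourhood of $0$ and $z(0)=0$ (differentiability over $\mathbb K$, i.e. holomorphy if $\mathbb K=\mathbb C$). Put $L(\varepsilon)=G'[z(\varepsilon)]$ and $\mathcal B_0=\frac12 G''[0]$. Assume: * $z$ is an approximation of order $2k$: $G[z(\varepsilon)]=\varepsilon^{2k}\,\bar b(\varepsilon)$ for $\varepsilon\in U$, with $\bar b$ continuous at $0$. * $L$ is $k$-surjective: for every $y\in\bar B$ there is a curve $b(\varepsilon)=b_0+\varepsilon b_1+\dots+\varepsilon^k b_k$ with $L(\varepsilon)b(\varepsilon)=\varepsilon^k y+O(\varepsilon^{k+1})$. * There are direct sums of closed subspaces $B=N_1^c\oplus\dots\oplus N_{k+1}^c\oplus N_{k+1}$ and $\bar B=R_1\oplus\dots\oplus R_{k+1}$, generated by the Jordan chains of $L$. That is, for $0\le i\le k+1$ the set of all $b_0$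 for which some curve $b(\varepsilon)=b_0+\dots+\varepsilon^i b_i$ satisfies $L(\varepsilon)b(\varepsilon)=O(\varepsilon^i)$ equals $N_{i+1}^c\oplus\dots\oplus N_{k+1}^c\oplus N_{k+1}$ (equals $N_{k+1}$ if $i=k+1$); and for $0\le i\le k$ the set of all $y$ for which some curve $b(\varepsilon)=b_0+\dots+\varepsilon^i b_i$ satisfies $L(\varepsilon)b(\varepsilon)=\varepsilon^i y+O(\varepsilon^{i+1})$ equals $R_1\oplus\dots\oplus R_{i+1}$. Let $\mathcal P_i$ be the projection of $\bar B$ to $R_i$ along the other summands. Then there exist isomorphisms $S_i\in GL[N_i^c,R_i]$, $i=1,\dots,k+1$, and a polynomial $p_k(\varepsilon)=I_B+\varepsilon\phi_1+\dots+\varepsilon^k\phi_k$ with bounded linear $\phi_j: B\to N_1^c\oplus\dots\oplus N_{k+1-j}^c$ such that $$L(\varepsilon)p_k(\varepsilon)n_{i+1}^c=\varepsilon^iS_{i+1}n_{i+1}^c+O(\varepsilon^{i+1})\quad(n_{i+1}^c\in N_{i+1}^c,\ 0\le i\le k),\qquad L(\varepsilon)p_k(\varepsilon)n_{k+1}=O(\varepsilon^{k+1})\quad(n_{k+1}\in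 N_{k+1}).\tag{$*$}$$ For all $S_i$ and $p_k$ of this kind satisfying $(*)$ the following holds. **(i)** For every $\kappa>0$ there is $\eta>0$, depending only on $\kappa$, the direct sums, $S_{k+1}$ and $\mathcal B_0$, such that if $\|\mathcal P_{k+1}\bar b(0)\|<\eta$, then there are $\rho,\delta>0$ with $\{|\varepsilon|<\rho\}\subset U$ and a $C^m$ mapping $(\bar n_1^c,\dots,\bar n_{k+1}^c)(\varepsilon,n_{k+1})\in N_1^c\times\dots\times N_{k+1}^c$, defined for $|\varepsilon|<\rho$ and $n_{k+1}\in N_{k+1}$, $\|n_{k+1}\|<\delta$, such that $$z=z(\varepsilon)+\varepsilon^k\,p_k(\varepsilon)\,\{\varepsilon^k\bar n_1^c+\dots+\varepsilon\,\bar n_k^c+\bar n_{k+1}^c+n_{k+1}\}$$ (all $\bar n_i^c$ evaluated at $(\varepsilon,n_{k+1})$) solves $G[z]=0$, and $\|\bar n_{k+1}^c(\varepsilon,n_{k+1})\|<\kappa$. At $\varepsilon=0$, the component $n_{k+1}^c=\bar n_{k+1}^c(0,n_{k+1})$ solves the quadratic equation $$S_{k+1}n_{k+1}^c+\mathcal P_{k+1}\mathcal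 B_0(n_{k+1}^c+n_{k+1})^2+\mathcal P_{k+1}\bar b(0)=0,$$ and the first $k$ components are $$\bar n_i^c(0,n_{k+1})=-S_i^{-1}\{\mathcal P_i\mathcal B_0[\bar n_{k+1}^c(0,n_{k+1})+n_{k+1}]^2+\mathcal P_i\bar b(0)\},\qquad i=1,\dots,k.$$ **(ii)** If $\mathcal B_0(n_{k+1}^c)^2=0$ for all $n_{k+1}^c\in N_{k+1}^c$, then, without any smallness of $\bar b(0)$, there are $\rho,\delta>0$ and a $C^m$ mapping $(\tilde n_1^c,\dots,\tilde n_{k+1}^c)(\varepsilon,n_{k+1})$ as in (i) giving solutions of $G[z]=0$ in the same form. For $\|n_{k+1}\|<\delta$ the operator $S_{k+1}+2\mathcal P_{k+1}\mathcal B_0 n_{k+1}$ belongs to $GL[N_{k+1}^c,R_{k+1}]$, and $$\tilde n_{k+1}^c(0,n_{k+1})=-(S_{k+1}+2\mathcal P_{k+1}\mathcal B_0n_{k+1})^{-1}\mathcal P_{k+1}[\mathcal B_0(n_{k+1})^2+\bar b(0)],$$ while $\tilde n_1^c(0,n_{k+1}),\dots,\tilde n_k^c(0,n_{k+1})$ are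 given by the formulas in (i) with $\bar n_{k+1}^c(0,n_{k+1})$ replaced by $\tilde n_{k+1}^c(0,n_{k+1})$. -/

import Mathlib

open Filter Topology

noncomputable section

/-- The polynomial curve `c 0 + ε • c 1 + ⋯ + ε ^ n • c n`. -/
def polyCurve {𝕜 X : Type*} [RCLike 𝕜] [NormedAddCommGroup X] [NormedSpace 𝕜 X]
    (n : ℕ) (c : ℕ → X) (ε : 𝕜) : X :=
  ∑ j ∈ Finset.range (n + 1), ε ^ j • c j

theorem polyCurve_zero_right {𝕜 X : Type*} [RCLike 𝕜] [NormedAddCommGroup X] [NormedSpace 𝕜 X]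
    (n : ℕ) (ε : 𝕜) : polyCurve n (0 : ℕ → X) ε = 0 := by
  simp [polyCurve]

theorem polyCurve_add {𝕜 X : Type*} [RCLike 𝕜] [NormedAddCommGroup X] [NormedSpace 𝕜 X]
    (n : ℕ) (c d : ℕ → X) (ε : 𝕜) :
    polyCurve n (c + d) ε = polyCurve n c ε + polyCurve n d ε := by
  simp [polyCurve, Finset.sum_add_distrib]

theorem polyCurve_smul {𝕜 X : Type*} [RCLike 𝕜] [NormedAddCommGroup X] [NormedSpace 𝕜 X]
    (n : ℕ) (a : 𝕜) (c : ℕ → X) (ε : 𝕜) :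
    polyCurve n (a • c) ε = a • polyCurve n c ε := by
  simp only [polyCurve, Pi.smul_apply, Finset.smul_sum]
  exact Finset.sum_congr rfl fun j _ => smul_comm _ _ _

/-- The elements of rank at least `i`: the root elements `b = b₀` of curves
`b(ε) = b₀ + ⋯ + ε ^ i • b_i` which are approximations of order `i`,
i.e. `L(ε) b(ε) = O(ε ^ i)`. -/
def rootSpace {𝕜 X Y : Type*} [RCLike 𝕜] [NormedAddCommGroup X] [NormedSpace 𝕜 X]
    [NormedAddCommGroup Y] [NormedSpace 𝕜 Y] (L : 𝕜 → X →L[𝕜] Y) (i : ℕ) : Submodule 𝕜 X where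
  carrier := {b | ∃ c : ℕ → X, c 0 = b ∧
    (fun ε : 𝕜 => L ε (polyCurve i c ε)) =O[𝓝 0] (fun ε : 𝕜 => ε ^ i)}
  zero_mem' := ⟨0, rfl, by
    simpa [polyCurve_zero_right] using Asymptotics.isBigO_zero (E' := Y) (fun ε : 𝕜 => ε ^ i) (𝓝 0)⟩
  add_mem' := by
    rintro _ _ ⟨c, rfl, hc⟩ ⟨d, rfl, hd⟩
    exact ⟨c + d, rfl, by simpa [polyCurve_add] using hc.add hd⟩
  smul_mem' := by
    rintro a _ ⟨c, rfl, hc⟩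
    exact ⟨a • c, rfl, (hc.const_smul_left a).congr_left fun ε => by simp [polyCurve_smul]⟩

/-- The leading coefficients of order `i`: all `y` such that
`L(ε) b(ε) = ε ^ i • y + O(ε ^ (i + 1))` for some curve `b(ε) = b₀ + ⋯ + ε ^ i • b_i`. -/
def leadSpace {𝕜 X Y : Type*} [RCLike 𝕜] [NormedAddCommGroup X] [NormedSpace 𝕜 X]
    [NormedAddCommGroup Y] [NormedSpace 𝕜 Y] (L : 𝕜 → X →L[𝕜] Y) (i : ℕ) : Submodule 𝕜 Y where
  carrier := {y | ∃ c : ℕ → X,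
    (fun ε : 𝕜 => L ε (polyCurve i c ε) - ε ^ i • y) =O[𝓝 0] (fun ε : 𝕜 => ε ^ (i + 1))}
  zero_mem' := ⟨0, by
    simpa [polyCurve_zero_right] using
      Asymptotics.isBigO_zero (E' := Y) (fun ε : 𝕜 => ε ^ (i + 1)) (𝓝 0)⟩
  add_mem' := by
    rintro y w ⟨c, hc⟩ ⟨d, hd⟩
    refine ⟨c + d, (hc.add hd).congr_left fun ε => ?_⟩
    simp only [polyCurve_add, map_add, smul_add]
    abel
  smul_mem' := by
    rintro a y ⟨c, hc⟩
    refine ⟨a • c, (hc.const_smul_left a).congr_left fun ε => ?_⟩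
    simp only [polyCurve_smul, map_smul, Pi.smul_apply, smul_sub]
    rw [smul_comm]

/-- `k`-surjectivity of the family `L`: for every `y` there is a curve
`b(ε) = b₀ + ⋯ + ε ^ k • b_k` with `L(ε) b(ε) = ε ^ k • y + O(ε ^ (k + 1))`. -/
def IsKSurjective {𝕜 X Y : Type*} [RCLike 𝕜] [NormedAddCommGroup X] [NormedSpace 𝕜 X]
    [NormedAddCommGroup Y] [NormedSpace 𝕜 Y] (L : 𝕜 → X →L[𝕜] Y) (k : ℕ) : Prop :=
  ∀ y : Y, ∃ c : ℕ → X,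
    (fun ε : 𝕜 => L ε (polyCurve k c ε) - ε ^ k • y) =O[𝓝 0] (fun ε : 𝕜 => ε ^ (k + 1))

/-- Direct sums of closed subspaces
`X = N₁ᶜ ⊕ ⋯ ⊕ N_{k+1}ᶜ ⊕ N_{k+1}` and `Y = R₁ ⊕ ⋯ ⊕ R_{k+1}`.
Indices are shifted by one: `M i` with `i ≤ k` is `N_{i+1}ᶜ`, `M (k + 1)` is `N_{k+1}`,
and `R i` is `R_{i+1}`. -/
structure ClosedDirectSums (𝕜 X Y : Type*) [RCLike 𝕜] [NormedAddCommGroup X] [NormedSpace 𝕜 X]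
    [NormedAddCommGroup Y] [NormedSpace 𝕜 Y] (k : ℕ) where
  M : Fin (k + 2) → Submodule 𝕜 X
  R : Fin (k + 1) → Submodule 𝕜 Y
  isClosed_M : ∀ i, IsClosed (M i : Set X)
  isClosed_R : ∀ i, IsClosed (R i : Set Y)
  internal_M : DirectSum.IsInternal M
  internal_R : DirectSum.IsInternal R

namespace ClosedDirectSums

variable {𝕜 X Y : Type*} [RCLike 𝕜] [NormedAddCommGroup X] [NormedSpace 𝕜 X]
    [NormedAddCommGroup Y] [NormedSpace 𝕜 Y] {k : ℕ}

/-- The subspace `N_{i+1}ᶜ`, for `i = 0, …, k`. -/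
abbrev Nc (D : ClosedDirectSums 𝕜 X Y k) (i : Fin (k + 1)) : Submodule 𝕜 X := D.M i.castSucc

/-- The remaining subspace `N_{k+1}`. -/
abbrev N (D : ClosedDirectSums 𝕜 X Y k) : Submodule 𝕜 X := D.M (Fin.last (k + 1))

/-- The projection of `Y` to `R i` with respect to the direct sum of `Y`. -/
def proj (D : ClosedDirectSums 𝕜 X Y k) (i : Fin (k + 1)) : Y →ₗ[𝕜] D.R i :=
  letI := D.internal_R.chooseDecomposition
  DirectSum.component 𝕜 (Fin (k + 1)) (fun j => D.R j) i ∘ₗ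
    (DirectSum.decomposeLinearEquiv D.R).toLinearMap

/-- The direct sums are those generated by the Jordan chains of the family `L`: the elements of
rank at least `i` form `N_{i+1}ᶜ ⊕ ⋯ ⊕ N_{k+1}ᶜ ⊕ N_{k+1}` (for `i ≤ k`), respectively `N_{k+1}`
(for `i = k + 1`), and the leading coefficients of order `i` form `R₁ ⊕ ⋯ ⊕ R_{i+1}`. -/
structure IsGeneratedBy (D : ClosedDirectSums 𝕜 X Y k) (L : 𝕜 → X →L[𝕜] Y) : Prop where
  root_eq : ∀ i : Fin (k + 2), rootSpace L (i : ℕ) = ⨆ (j : Fin (k + 2)) (_ : i ≤ j), D.M j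
  lead_eq : ∀ i : Fin (k + 1), leadSpace L (i : ℕ) = ⨆ (j : Fin (k + 1)) (_ : j ≤ i), D.R j

end ClosedDirectSums

/-- The operator polynomial `p_k(ε) = φ₀ + ε • φ₁ + ⋯ + ε ^ k • φ_k`. -/
def opPoly {𝕜 X : Type*} [RCLike 𝕜] [NormedAddCommGroup X] [NormedSpace 𝕜 X]
    (k : ℕ) (φ : ℕ → X →L[𝕜] X) (ε : 𝕜) : X →L[𝕜] X :=
  ∑ j ∈ Finset.range (k + 1), ε ^ j • φ j

/-- `φ` are the coefficients of a polynomial family `p_k(ε)` of Jordan chains of `L` and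
`S i : N_{i+1}ᶜ ≃ R_{i+1}` are the associated operators of leading coefficients. -/
structure IsJordanPolynomial {𝕜 X Y : Type*} [RCLike 𝕜] [NormedAddCommGroup X] [NormedSpace 𝕜 X]
    [NormedAddCommGroup Y] [NormedSpace 𝕜 Y] {k : ℕ} (D : ClosedDirectSums 𝕜 X Y k)
    (L : 𝕜 → X →L[𝕜] Y) (S : ∀ i : Fin (k + 1), D.Nc i ≃L[𝕜] D.R i)
    (φ : ℕ → X →L[𝕜] X) : Prop where
  coeff_zero : φ 0 = ContinuousLinearMap.id 𝕜 X
  coeff_mem : ∀ j : ℕ, 1 ≤ j → j ≤ k → ∀ x : X,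
    φ j x ∈ ⨆ (i : Fin (k + 1)) (_ : (i : ℕ) + j ≤ k), D.Nc i
  lead : ∀ (i : Fin (k + 1)) (x : D.Nc i),
    (fun ε : 𝕜 => L ε (opPoly k φ ε (x : X)) - ε ^ (i : ℕ) • (S i x : Y))
      =O[𝓝 0] (fun ε : 𝕜 => ε ^ ((i : ℕ) + 1))
  null : ∀ x : D.N,
    (fun ε : 𝕜 => L ε (opPoly k φ ε (x : X))) =O[𝓝 0] (fun ε : 𝕜 => ε ^ (k + 1))

/-- The family `L(ε) = G'[z(ε)]` of directional derivatives along the curve `z`. -/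
def derivAlong {𝕜 X Y : Type*} [RCLike 𝕜] [NormedAddCommGroup X] [NormedSpace 𝕜 X]
    [NormedAddCommGroup Y] [NormedSpace 𝕜 Y] (G : X → Y) (z : 𝕜 → X) (ε : 𝕜) : X →L[𝕜] Y :=
  fderiv 𝕜 G (z ε)

/-- The curvature `½ G''[0]` at the origin. -/
def curvatureAtZero (𝕜 : Type*) {X Y : Type*} [RCLike 𝕜] [NormedAddCommGroup X]
    [NormedSpace 𝕜 X] [NormedAddCommGroup Y] [NormedSpace 𝕜 Y] (G : X → Y) :
    X →L[𝕜] X →L[𝕜] Y :=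
  (2⁻¹ : 𝕜) • fderiv 𝕜 (fderiv 𝕜 G) 0

/-- `G` is a mapping and `z` a curve of class `C ^ r` through `0`, defined on a neighbourhood `U`
of `0`, and `z` is an approximation of order `q` of a solution: `G[z(ε)] = ε ^ q • bbar(ε)`. -/
structure IsApproximation {𝕜 X Y : Type*} [RCLike 𝕜] [NormedAddCommGroup X] [NormedSpace 𝕜 X]
    [NormedAddCommGroup Y] [NormedSpace 𝕜 Y] (r : ℕ∞) (q : ℕ) (U : Set 𝕜) (G : X → Y)
    (z : 𝕜 → X) (bbar : 𝕜 → Y) : Prop where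
  isOpen : IsOpen U
  zero_mem : (0 : 𝕜) ∈ U
  contDiff_map : ContDiff 𝕜 (r : WithTop ℕ∞) G
  contDiffOn_curve : ContDiffOn 𝕜 (r : WithTop ℕ∞) z U
  curve_zero : z 0 = 0
  approx : ∀ ε ∈ U, G (z ε) = ε ^ q • bbar ε
  continuousAt_remainder : ContinuousAt bbar 0

/-- `nc = (nc₁, …, nc_{k+1})`, a map to `N₁ᶜ × ⋯ × N_{k+1}ᶜ`, is of class `C ^ m` for `‖ε‖ < ρ`,
`‖n‖ < δ`, `n ∈ N_{k+1}`, where the disc `‖ε‖ < ρ` lies in `U`, and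
`z(ε) + ε ^ k p_k(ε) {ε ^ k nc₁ + ⋯ + ε nc_k + nc_{k+1} + n}` solves `G = 0`. -/
structure IsSolutionMap {𝕜 X Y : Type*} [RCLike 𝕜] [NormedAddCommGroup X] [NormedSpace 𝕜 X]
    [NormedAddCommGroup Y] [NormedSpace 𝕜 Y] {k : ℕ} (D : ClosedDirectSums 𝕜 X Y k)
    (m : ℕ∞) (U : Set 𝕜) (G : X → Y) (z : 𝕜 → X) (φ : ℕ → X →L[𝕜] X) (ρ δ : ℝ)
    (nc : 𝕜 × D.N → ∀ i : Fin (k + 1), D.Nc i) : Prop where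
  subset : Metric.ball (0 : 𝕜) ρ ⊆ U
  contDiffOn : ContDiffOn 𝕜 (m : WithTop ℕ∞) nc
    (Metric.ball (0 : 𝕜) ρ ×ˢ Metric.ball (0 : D.N) δ)
  solves : ∀ ε ∈ Metric.ball (0 : 𝕜) ρ, ∀ n ∈ Metric.ball (0 : D.N) δ,
    G (z ε + ε ^ k • opPoly k φ ε
      ((∑ i : Fin (k + 1), ε ^ (k - (i : ℕ)) • (nc (ε, n) i : X)) + (n : X))) = 0

/-- The formulas `nc_i = -S_i⁻¹ {P_i B₀ [nc_{k+1} + n]² + P_i bbar(0)}`, `i = 1, …, k`,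
for the first `k` components at `ε = 0`. -/
def FirstComponentsFormula {𝕜 X Y : Type*} [RCLike 𝕜] [NormedAddCommGroup X] [NormedSpace 𝕜 X]
    [NormedAddCommGroup Y] [NormedSpace 𝕜 Y] {k : ℕ} (D : ClosedDirectSums 𝕜 X Y k)
    (S : ∀ i : Fin (k + 1), D.Nc i ≃L[𝕜] D.R i) (B₀ : X →L[𝕜] X →L[𝕜] Y) (b₀ : Y)
    (n : D.N) (v : ∀ i : Fin (k + 1), D.Nc i) : Prop :=
  ∀ i : Fin (k + 1), i ≠ Fin.last k →
    v i = -(S i).symm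
      (D.proj i (B₀ ((v (Fin.last k) : X) + n) ((v (Fin.last k) : X) + n)) + D.proj i b₀)

end

/-! Blocks are numbered from 0 to k, as in the definitions. Let w be p_k(ε) applied to the braces of
the ansatz. Expanding at the moving base point z(ε) gives G[z(ε) + ε^k w] = G[z(ε)] + ε^k L(ε) w +
ε^(2k) B₀ w² + o(ε^(2k)), by `isLittleO_second_order`. The weight ε^(k-i) of the component u_i
compensates the order ε^i of its Jordan chain, so L(ε) w = ε^k ∑ S_i u_i + O(ε^(k+1)) and every term
has order 2k (`isLittleO_ansatz`). Division by ε^(2k) costs 2k derivatives and leaves a C^m map g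
with g(0, n, u) = bbar(0) + ∑ S_i u_i + B₀(u_k + n)² (`exists_contDiffOn_reduced`).

The equation g = 0 is solved for u by the implicit function theorem at ε = 0, n = 0. The quadratic
term sees only u_k, so the linearization in u is triangular (`isInvertible_reduced`). It therefore
suffices to have a root x₀ of the last component at which the derivative of that component is
invertible (`exists_isSolutionMap`). In (i) the root comes from the inverse function theorem
(`exists_small_quadratic_solution`); in (ii) the last component is affine when n = 0, with linear
part S_k.

The chains themselves are built order by order (`ClosedDirectSums.IsJordanStage.exists_succ`):
shifted lower chains remove the components in R_l, l < i, of the order-i residual, and what remains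
maps M_i isomorphically onto R_i. -/

noncomputable section

/-! ### Smooth dependence of integrals over [0, 1] on a parameter. -/

section ParametricIntegral

variable {𝕜 X E : Type*} [RCLike 𝕜] [NormedAddCommGroup X] [NormedAddCommGroup E]
  {Ω : Set (𝕜 × X)} {s : Set X}

theorem continuousOn_unitInterval_slice {H : 𝕜 × X → E} (hH : ContinuousOn H Ω)
    (hs : ∀ x ∈ s, ∀ t ∈ Set.Icc (0 : ℝ) 1, ((t : 𝕜), x) ∈ Ω) {x : X} (hx : x ∈ s) :
    ContinuousOn (fun t : ℝ => H ((t : 𝕜), x)) (Set.uIcc 0 1) := by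
  rw [Set.uIcc_of_le zero_le_one]
  refine hH.comp (Continuous.continuousOn ?_) fun t ht => hs x hx t ht
  exact RCLike.continuous_ofReal.prodMk continuous_const

/-- Compactness of [0, 1] makes a bound at each t uniform in t; this supplies the constant majorant
for dominated convergence. -/
theorem eventually_bound_unitInterval {H : 𝕜 × X → E} (hΩ : IsOpen Ω) (hH : ContinuousOn H Ω)
    (hs : ∀ x ∈ s, ∀ t ∈ Set.Icc (0 : ℝ) 1, ((t : 𝕜), x) ∈ Ω) {x₀ : X} (hx₀ : x₀ ∈ s) :
    ∃ C : ℝ, ∀ᶠ x in 𝓝 x₀, ∀ t ∈ Set.Icc (0 : ℝ) 1, ‖H ((t : 𝕜), x)‖ ≤ C := by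
  have hcont := continuousOn_unitInterval_slice hH hs hx₀
  rw [Set.uIcc_of_le zero_le_one] at hcont
  obtain ⟨C, hC⟩ := isCompact_Icc.exists_bound_of_continuousOn hcont
  refine ⟨C + 1, IsCompact.eventually_forall_of_forall_eventually (K := Set.Icc (0 : ℝ) 1)
    (P := fun (x : X) (t : ℝ) => ‖H ((t : 𝕜), x)‖ ≤ C + 1) isCompact_Icc fun t ht => ?_⟩
  have hc : ContinuousAt (fun q : X × ℝ => ‖H ((q.2 : 𝕜), q.1)‖) (x₀, t) := by
    refine ContinuousAt.norm ?_
    refine ContinuousAt.comp (g := H) (f := fun q : X × ℝ => ((q.2 : 𝕜), q.1))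
      (hH.continuousAt (hΩ.mem_nhds (hs x₀ hx₀ t ht))) ?_
    exact ((RCLike.continuous_ofReal.comp continuous_snd).prodMk continuous_fst).continuousAt
  exact (hc.eventually_lt_const (lt_of_le_of_lt (hC t ht) (lt_add_one C))).mono fun _ h => h.le

theorem continuousOn_integral_unitInterval [NormedSpace ℝ E] {H : 𝕜 × X → E} (hΩ : IsOpen Ω) (hso : IsOpen s)
    (hH : ContinuousOn H Ω)
    (hs : ∀ x ∈ s, ∀ t ∈ Set.Icc (0 : ℝ) 1, ((t : 𝕜), x) ∈ Ω) :
    ContinuousOn (fun x => ∫ t in (0 : ℝ)..1, H ((t : 𝕜), x)) s := by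
  intro x₀ hx₀
  refine ContinuousAt.continuousWithinAt ?_
  obtain ⟨C, hC⟩ := eventually_bound_unitInterval hΩ hH hs hx₀
  refine intervalIntegral.continuousAt_of_dominated_interval (bound := fun _ => C) ?_ ?_
    intervalIntegrable_const ?_
  · filter_upwards [hso.mem_nhds hx₀] with x hx
    exact (continuousOn_unitInterval_slice hH hs hx).intervalIntegrable.def'.aestronglyMeasurable
  · filter_upwards [hC] with x hx
    refine Eventually.of_forall fun t ht => hx t ?_
    rw [Set.uIoc_of_le zero_le_one] at ht
    exact Set.Ioc_subset_Icc_self ht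
  · refine Eventually.of_forall fun t ht => ?_
    rw [Set.uIoc_of_le zero_le_one] at ht
    refine ContinuousAt.comp (g := H) (f := fun x : X => ((t : 𝕜), x))
      (hH.continuousAt (hΩ.mem_nhds (hs x₀ hx₀ t (Set.Ioc_subset_Icc_self ht)))) ?_
    fun_prop

theorem hasFDerivAt_integral_unitInterval [NormedSpace 𝕜 X] [NormedSpace ℝ E] [NormedSpace 𝕜 E]
    [SMulCommClass 𝕜 ℝ E] {H : 𝕜 × X → E} {H' : 𝕜 × X → X →L[𝕜] E} (hΩ : IsOpen Ω) (hso : IsOpen s)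
    (hH : ContinuousOn H Ω) (hH' : ContinuousOn H' Ω)
    (hs : ∀ x ∈ s, ∀ t ∈ Set.Icc (0 : ℝ) 1, ((t : 𝕜), x) ∈ Ω)
    (hd : ∀ x ∈ s, ∀ t ∈ Set.Icc (0 : ℝ) 1,
      HasFDerivAt (fun x => H ((t : 𝕜), x)) (H' ((t : 𝕜), x)) x) {x₀ : X} (hx₀ : x₀ ∈ s) :
    HasFDerivAt (fun x => ∫ t in (0 : ℝ)..1, H ((t : 𝕜), x))
      (∫ t in (0 : ℝ)..1, H' ((t : 𝕜), x₀)) x₀ := by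
  obtain ⟨C, hC⟩ := eventually_bound_unitInterval hΩ hH' hs hx₀
  refine intervalIntegral.hasFDerivAt_integral_of_dominated_of_fderiv_le
    (F := fun x (t : ℝ) => H ((t : 𝕜), x)) (F' := fun x (t : ℝ) => H' ((t : 𝕜), x))
    (bound := fun _ => C) (hC.and (hso.mem_nhds hx₀)) ?_ ?_ ?_ ?_ intervalIntegrable_const ?_
  · filter_upwards [hso.mem_nhds hx₀] with x hx
    exact (continuousOn_unitInterval_slice hH hs hx).intervalIntegrable.def'.aestronglyMeasurable
  · exact (continuousOn_unitInterval_slice hH hs hx₀).intervalIntegrable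
  · exact (continuousOn_unitInterval_slice hH' hs hx₀).intervalIntegrable.def'.aestronglyMeasurable
  · refine Eventually.of_forall fun t ht x hx => hx.1 t ?_
    rw [Set.uIoc_of_le zero_le_one] at ht
    exact Set.Ioc_subset_Icc_self ht
  · refine Eventually.of_forall fun t ht x hx => hd x hx.2 t ?_
    rw [Set.uIoc_of_le zero_le_one] at ht
    exact Set.Ioc_subset_Icc_self ht

/-- A Taylor series of the integral is the integral of the Taylor series of H, restricted to the X
directions by precomposing with `inr`. Handling the whole series at once covers n = ∞ without
induction. -/
theorem contDiffOn_integral_unitInterval [NormedSpace 𝕜 X] [NormedSpace ℝ E] [NormedSpace 𝕜 E]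
    [SMulCommClass 𝕜 ℝ E] [CompleteSpace E] {n : ℕ∞} {H : 𝕜 × X → E} (hΩ : IsOpen Ω) (hso : IsOpen s)
    (hH : ContDiffOn 𝕜 n H Ω)
    (hs : ∀ x ∈ s, ∀ t ∈ Set.Icc (0 : ℝ) 1, ((t : 𝕜), x) ∈ Ω) :
    ContDiffOn 𝕜 n (fun x => ∫ t in (0 : ℝ)..1, H ((t : 𝕜), x)) s := by
  have hp := hH.ftaylorSeriesWithin hΩ.uniqueDiffOn
  set p := ftaylorSeriesWithin 𝕜 H Ω
  let ι : ∀ m : ℕ, ((𝕜 × X) [×m]→L[𝕜] E) →L[𝕜] (X [×m]→L[𝕜] E) := fun m =>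
    ContinuousMultilinearMap.compContinuousLinearMapL fun _ => ContinuousLinearMap.inr 𝕜 𝕜 X
  have hcont : ∀ m : ℕ, (m : WithTop ℕ∞) ≤ n → ContinuousOn (fun y => ι m (p y m)) Ω :=
    fun m hm => (ι m).continuous.comp_continuousOn (hp.cont m hm)
  refine HasFTaylorSeriesUpToOn.contDiffOn
    (f' := fun x m => ∫ t in (0 : ℝ)..1, ι m (p ((t : 𝕜), x) m)) ⟨?_, ?_, ?_⟩
  · intro x hx
    have h0 := ContinuousLinearMap.intervalIntegral_comp_comm (𝕜 := 𝕜)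
      (μ := MeasureTheory.volume) (a := 0) (b := 1)
      ((continuousMultilinearCurryFin0 𝕜 X E).toContinuousLinearEquiv : _ →L[𝕜] E)
      (continuousOn_unitInterval_slice (hcont 0 (by simp)) hs hx).intervalIntegrable
    refine h0.symm.trans (intervalIntegral.integral_congr fun t ht => ?_)
    rw [Set.uIcc_of_le zero_le_one] at ht
    have h1 := hp.zero_eq _ (hs x hx t ht)
    rw [← h1]
    rfl
  · intro m hm x hx
    have hm' : ((m.succ : ℕ) : WithTop ℕ∞) ≤ n := by
      have hm' : (m : ℕ∞) < n := by exact_mod_cast hm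
      exact_mod_cast Order.add_one_le_of_lt hm'
    refine HasFDerivAt.hasFDerivWithinAt ?_
    let cu : (X [×m.succ]→L[𝕜] E) →L[𝕜] (X →L[𝕜] (X [×m]→L[𝕜] E)) :=
      ((continuousMultilinearCurryLeftEquiv 𝕜 (fun _ : Fin m.succ => X) E).toContinuousLinearEquiv :
        _ →L[𝕜] _)
    have h0 := ContinuousLinearMap.intervalIntegral_comp_comm (𝕜 := 𝕜)
      (F := X →L[𝕜] (X [×m]→L[𝕜] E)) (μ := MeasureTheory.volume) (a := 0) (b := 1) cu
      (continuousOn_unitInterval_slice (hcont m.succ hm') hs hx).intervalIntegrable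
    have h1 := hasFDerivAt_integral_unitInterval (H' := fun y => cu (ι m.succ (p y m.succ)))
      hΩ hso (hcont m hm.le) (cu.continuous.comp_continuousOn (hcont m.succ hm')) hs
      (fun x hx t ht => ?_) hx
    · rw [h0] at h1
      exact h1
    · have h2 := (hp.comp_continuousAffineMap ((ContinuousAffineMap.const 𝕜 X (t : 𝕜)).prod
        (ContinuousAffineMap.id 𝕜 X))).fderivWithin m hm x (hs x hx t ht)
      have h3 : (((ContinuousAffineMap.const 𝕜 X (t : 𝕜)).prod
        (ContinuousAffineMap.id 𝕜 X)).contLinear) = ContinuousLinearMap.inr 𝕜 𝕜 X := by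
        ext x
        · simp
        · simp
          rfl
      rw [h3] at h2
      exact h2.hasFDerivAt ((hΩ.preimage (by fun_prop)).mem_nhds (hs x hx t ht))
  · exact fun m hm => continuousOn_integral_unitInterval hΩ hso (hcont m hm) hs

end ParametricIntegral

/-! ### Hadamard division by powers of ε and Taylor expansion. -/

section Division

variable {𝕜 P E : Type*} [RCLike 𝕜] [NormedAddCommGroup P] [NormedSpace 𝕜 P]
  [NormedAddCommGroup E] [NormedSpace 𝕜 E] [CompleteSpace E]

/-- Hadamard's lemma: a function vanishing on `{0} × P` is divisible by the first variable. -/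
theorem exists_contDiffOn_eq_smul {n : ℕ∞} {ρ : ℝ} {f : 𝕜 × P → E}
    (hf : ContDiffOn 𝕜 (n + 1 : ℕ∞) f (Metric.ball (0 : 𝕜) ρ ×ˢ Set.univ))
    (h0 : ∀ u, f (0, u) = 0) :
    ∃ g : 𝕜 × P → E, ContDiffOn 𝕜 n g (Metric.ball (0 : 𝕜) ρ ×ˢ Set.univ) ∧
      ∀ x ∈ Metric.ball (0 : 𝕜) ρ ×ˢ (Set.univ : Set P), f x = x.1 • g x := by
  let : NormedSpace ℝ E := NormedSpace.restrictScalars ℝ 𝕜 E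
  have : IsScalarTower ℝ 𝕜 E := RestrictScalars.isScalarTower ℝ 𝕜 E
  set s : Set (𝕜 × P) := Metric.ball (0 : 𝕜) ρ ×ˢ Set.univ with hs_def
  have hso : IsOpen s := Metric.isOpen_ball.prod isOpen_univ
  have hstar : ∀ x ∈ s, ∀ t ∈ Set.Icc (0 : ℝ) 1, ((t : 𝕜) * x.1, x.2) ∈ s := by
    rintro x ⟨hx, -⟩ t ht
    refine ⟨?_, trivial⟩
    rw [mem_ball_zero_iff] at hx ⊢
    refine lt_of_le_of_lt ?_ hx
    rw [norm_mul, RCLike.norm_ofReal, abs_of_nonneg ht.1]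
    exact mul_le_of_le_one_left (norm_nonneg _) ht.2
  -- The quotient is the integral over real t in [0, 1] of the ε-derivative of f at (tε, u). The
  -- real segment stays in the ball, so the same formula serves 𝕜 = ℝ and 𝕜 = ℂ.
  let d : 𝕜 × P → E := fun y => fderiv 𝕜 f y (1, 0)
  have hd : ContDiffOn 𝕜 n d s :=
    (hf.fderiv_of_isOpen hso (m := n) (by norm_cast)).clm_apply contDiffOn_const
  let A : 𝕜 × (𝕜 × P) → 𝕜 × P := fun y => (y.1 * y.2.1, y.2.2)
  have hA : ContDiff 𝕜 n A := by fun_prop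
  refine ⟨fun x => ∫ t in (0 : ℝ)..1, d (A ((t : 𝕜), x)),
    contDiffOn_integral_unitInterval (H := d ∘ A) (Ω := A ⁻¹' s) (hso.preimage hA.continuous) hso
      (hd.comp hA.contDiffOn fun _ h => h) hstar, fun x hx => ?_⟩
  have hderiv : ∀ t ∈ Set.uIcc (0 : ℝ) 1,
      HasDerivAt (fun t : ℝ => f ((t : 𝕜) * x.1, x.2)) (x.1 • d (A ((t : 𝕜), x))) t := by
    intro t ht
    rw [Set.uIcc_of_le zero_le_one] at ht
    have hmem := hstar x hx t ht
    have hfd : HasFDerivAt f (fderiv 𝕜 f (A ((t : 𝕜), x))) (A ((t : 𝕜), x)) :=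
      ((hf.contDiffAt (hso.mem_nhds hmem)).differentiableAt (by simp)).hasFDerivAt
    have h1 : HasDerivAt (fun τ : 𝕜 => ((τ * x.1, x.2) : 𝕜 × P)) (x.1, 0) (t : 𝕜) := by
      simpa using ((hasDerivAt_id (t : 𝕜)).mul_const x.1).prodMk (hasDerivAt_const (t : 𝕜) x.2)
    have h2 := hfd.comp_hasDerivAt (t : 𝕜) h1
    have h3 : HasDerivAt (fun τ : ℝ => (τ : 𝕜)) (1 : 𝕜) t :=
      (RCLike.ofRealCLM (K := 𝕜)).hasDerivAt.congr_deriv (by simp)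
    have h4 := HasDerivAt.scomp t h2 h3
    convert! h4 using 1
    rw [one_smul]
    simp only [d]
    rw [← map_smul]
    simp
  have hint : IntervalIntegrable (fun t : ℝ => x.1 • d (A ((t : 𝕜), x)))
      MeasureTheory.volume 0 1 := by
    refine (ContinuousOn.const_smul ?_ x.1).intervalIntegrable
    exact continuousOn_unitInterval_slice (H := d ∘ A) (Ω := A ⁻¹' s)
      (hd.continuousOn.comp hA.continuous.continuousOn fun _ h => h) hstar hx
  have := intervalIntegral.integral_eq_sub_of_hasDerivAt hderiv hint
  rw [intervalIntegral.integral_smul] at this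
  rw [this]
  simp [h0]

/-- Hadamard's lemma is iterated, one derivative per factor ε. The bound is only asked on a
punctured neighbourhood because it is divided by ε at each round; the value at 0 returns by
continuity. -/
theorem exists_contDiffOn_eq_pow_smul {n : ℕ∞} {ρ : ℝ} (hρ : 0 < ρ) (q : ℕ) {f : 𝕜 × P → E}
    (hf : ContDiffOn 𝕜 (n + q : ℕ∞) f (Metric.ball (0 : 𝕜) ρ ×ˢ Set.univ))
    (hO : ∀ u, (fun ε : 𝕜 => f (ε, u)) =O[𝓝[≠] 0] fun ε => ε ^ q) :
    ∃ g : 𝕜 × P → E, ContDiffOn 𝕜 n g (Metric.ball (0 : 𝕜) ρ ×ˢ Set.univ) ∧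
      ∀ x ∈ Metric.ball (0 : 𝕜) ρ ×ˢ (Set.univ : Set P), f x = x.1 ^ q • g x := by
  induction q generalizing f with
  | zero => exact ⟨f, by simpa using hf, by simp⟩
  | succ q ih =>
    have h0 : ∀ u, f (0, u) = 0 := by
      intro u
      have hc : ContinuousAt (fun ε : 𝕜 => f (ε, u)) 0 := by
        refine ContinuousAt.comp (g := f) (f := fun ε : 𝕜 => (ε, u)) ?_ (by fun_prop)
        exact hf.continuousOn.continuousAt
          ((Metric.isOpen_ball.prod isOpen_univ).mem_nhds ⟨Metric.mem_ball_self hρ, trivial⟩)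
      refine tendsto_nhds_unique (hc.tendsto.mono_left nhdsWithin_le_nhds)
        ((hO u).trans_tendsto ?_)
      have : Tendsto (fun ε : 𝕜 => ε ^ (q + 1)) (𝓝 0) (𝓝 (0 ^ (q + 1))) :=
        (continuous_pow (q + 1)).tendsto 0
      rw [zero_pow q.succ_ne_zero] at this
      exact this.mono_left nhdsWithin_le_nhds
    obtain ⟨g, hg, hfg⟩ := exists_contDiffOn_eq_smul (n := n + q)
      (by simpa [add_assoc] using hf) h0
    obtain ⟨g', hg', hgg'⟩ := ih hg fun u => by
      obtain ⟨C, hC⟩ := (hO u).bound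
      refine Asymptotics.IsBigO.of_bound C ?_
      filter_upwards [hC, self_mem_nhdsWithin,
        nhdsWithin_le_nhds (Metric.ball_mem_nhds (0 : 𝕜) hρ)] with ε h1 h2 h3
      rw [hfg (ε, u) ⟨h3, trivial⟩, norm_smul, pow_succ', norm_mul, mul_left_comm] at h1
      exact le_of_mul_le_mul_left h1 (norm_pos_iff.2 h2)
    exact ⟨g', hg', fun x hx => by rw [hfg x hx, hgg' x hx, smul_smul, pow_succ']⟩

theorem exists_taylor_isBigO {ρ : ℝ} (hρ : 0 < ρ) (q : ℕ) {f : 𝕜 → E}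
    (hf : ContDiffOn 𝕜 (q : ℕ∞) f (Metric.ball (0 : 𝕜) ρ)) :
    ∃ c : ℕ → E, (fun ε : 𝕜 => f ε - ∑ j ∈ Finset.range q, ε ^ j • c j) =O[𝓝 0]
      fun ε => ε ^ q := by
  induction q generalizing f with
  | zero =>
    refine ⟨0, ?_⟩
    have hc := hf.continuousOn.continuousAt (Metric.ball_mem_nhds (0 : 𝕜) hρ)
    simpa using! hc.norm.isBoundedUnder_le.isBigO_one 𝕜
  | succ q ih =>
    -- The parameter space 𝕜 is a dummy, evaluated at 0.
    obtain ⟨g, hg, hfg⟩ := exists_contDiffOn_eq_smul (P := 𝕜) (n := q) (ρ := ρ)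
      (f := fun x => f x.1 - f 0)
      (((hf.comp contDiffOn_fst fun _ h => h.1).sub contDiffOn_const).of_le (by norm_cast)) (by simp)
    obtain ⟨c, hc⟩ := ih (f := fun ε => g (ε, 0))
      (hg.comp (by fun_prop) fun ε hε => ⟨hε, trivial⟩)
    refine ⟨fun j => Nat.casesOn j (f 0) c, ?_⟩
    have h1 := (Asymptotics.isBigO_refl (fun ε : 𝕜 => ε) (𝓝 0)).smul hc
    refine h1.congr' ?_ (Eventually.of_forall fun ε => by simp [pow_succ'])
    filter_upwards [Metric.ball_mem_nhds (0 : 𝕜) hρ] with ε hε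
    have h2 := hfg (ε, 0) ⟨hε, trivial⟩
    simp only at h2
    rw [Finset.sum_range_succ', smul_sub, ← h2, Finset.smul_sum]
    simp only [smul_smul, pow_succ', pow_zero, one_smul]
    change f ε - f 0 - _ = f ε - (_ + f 0)
    abel

end Division

/-! ### The implicit function theorem with uniform smoothness. -/

section ImplicitFunction

variable {𝕜 E₁ E₂ F : Type*} [RCLike 𝕜]
  [NormedAddCommGroup E₁] [NormedSpace 𝕜 E₁] [CompleteSpace E₁]
  [NormedAddCommGroup E₂] [NormedSpace 𝕜 E₂] [CompleteSpace E₂]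
  [NormedAddCommGroup F] [NormedSpace 𝕜 F] [CompleteSpace F]

/-- The implicit function theorem with a solution that is of class `C ^ n` on a fixed
neighbourhood, also for `n = ∞`. -/
theorem exists_contDiffAt_implicit_eventually {n : WithTop ℕ∞} (hn : n ≠ 0) {f : E₁ × E₂ → F}
    {u : E₁ × E₂} (hf : ∀ᶠ v in 𝓝 u, ContDiffAt 𝕜 n f v)
    (hinv : (fderiv 𝕜 f u ∘L .inr 𝕜 E₁ E₂).IsInvertible) :
    ∃ ψ : E₁ → E₂, ψ u.1 = u.2 ∧ ContinuousAt ψ u.1 ∧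
      ∀ᶠ x in 𝓝 u.1, ContDiffAt 𝕜 n ψ x ∧ f (x, ψ x) = f u := by
  have hfu := hf.self_of_nhds
  set ψ := hfu.implicitFunction hn hinv with hψ
  have hψu : ψ u.1 = u.2 := hfu.implicitFunction_apply_self hn hinv
  have hψc : ContDiffAt 𝕜 n ψ u.1 := hfu.contDiffAt_implicitFunction hn hinv
  have hfd : ContinuousAt (fun v => fderiv 𝕜 f v ∘L .inr 𝕜 E₁ E₂) u :=
    ((hfu.fderiv_right (m := 0) (by simpa using ENat.one_le_iff_ne_zero_withTop.2 hn)).continuousAt).clm_comp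
      continuousAt_const
  have hinv' : ∀ᶠ v in 𝓝 u, (fderiv 𝕜 f v ∘L .inr 𝕜 E₁ E₂).IsInvertible := by
    obtain ⟨e, he⟩ := hinv
    have := hfd.eventually (he ▸ e.nhds)
    exact this
  have hlift : Tendsto (fun x => (x, ψ x)) (𝓝 u.1) (𝓝 u) := by
    have : ContinuousAt (fun x => (x, ψ x)) u.1 := continuousAt_id.prodMk hψc.continuousAt
    rw [ContinuousAt, hψu] at this
    exact this
  refine ⟨ψ, hψu, hψc.continuousAt, ?_⟩
  -- Smoothness at the single point u.1 would, for n = ∞, give neighbourhoods shrinking with the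
  -- order. Instead the theorem is applied again at each nearby (x, ψ x), and local uniqueness
  -- identifies the new solution with ψ.
  have huniq := (hfu.eventually_apply_eq_iff_implicitFunction hn hinv).eventually_nhds
  filter_upwards [hlift.eventually hf, hlift.eventually hinv', hlift.eventually huniq,
    hfu.eventually_apply_implicitFunction hn hinv] with x hfx hix hux hsx
  refine ⟨?_, hsx⟩
  have hself := hfx.implicitFunction_apply_self hn hix
  have hcx := hfx.contDiffAt_implicitFunction hn hix
  refine hcx.congr_of_eventuallyEq ?_
  have hlift' : Tendsto (fun y => (y, hfx.implicitFunction hn hix y)) (𝓝 x) (𝓝 (x, ψ x)) := by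
    have : ContinuousAt (fun y => (y, hfx.implicitFunction hn hix y)) x :=
      continuousAt_id.prodMk hcx.continuousAt
    rw [ContinuousAt, hself] at this
    exact this
  filter_upwards [hlift'.eventually hux, hfx.eventually_apply_implicitFunction hn hix] with y h1 h2
  exact h1.1 (h2.trans hsx)

end ImplicitFunction

/-! ### Continuous projections of finite direct sums of closed subspaces. -/

section InternalSum

variable {𝕜 X ι : Type*} [RCLike 𝕜] [NormedAddCommGroup X] [NormedSpace 𝕜 X]
  [Fintype ι] [DecidableEq ι] {A : ι → Submodule 𝕜 X}

theorem DirectSum.coeAddMonoidHom_eq_sum (a : DirectSum ι fun i => A i) :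
    DirectSum.coeAddMonoidHom A a = ∑ i, (a i : X) := by
  classical
  rw [DirectSum.coeAddMonoidHom_eq_dfinsuppSum, DFinsupp.sum_eq_sum_fintype _ (by simp)]
  rfl

variable [CompleteSpace X]

/-- A Banach space which is the direct sum of finitely many closed subspaces is isomorphic to
their product. -/
def DirectSum.IsInternal.piEquiv (h : DirectSum.IsInternal A) (hc : ∀ i, IsClosed (A i : Set X)) :
    (∀ i, A i) ≃L[𝕜] X :=
  haveI : ∀ i, CompleteSpace (A i) := fun i => (hc i).completeSpace_coe
  ContinuousLinearEquiv.ofBijective (∑ i, (A i).subtypeL ∘L ContinuousLinearMap.proj i)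
    (LinearMap.ker_eq_bot.2 (by
      intro u v huv
      apply (DirectSum.linearEquivFunOnFintype 𝕜 ι (fun i => A i)).symm.injective
      apply h.injective
      rw [DirectSum.coeAddMonoidHom_eq_sum, DirectSum.coeAddMonoidHom_eq_sum]
      simpa [DirectSum.linearEquivFunOnFintype] using! huv))
    (LinearMap.range_eq_top.2 (by
      intro x
      obtain ⟨a, rfl⟩ := h.surjective x
      refine ⟨DirectSum.linearEquivFunOnFintype 𝕜 ι (fun i => A i) a, ?_⟩
      rw [DirectSum.coeAddMonoidHom_eq_sum]
      simp))

/-- The continuous projection onto a summand. -/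
def DirectSum.IsInternal.projL (h : DirectSum.IsInternal A) (hc : ∀ i, IsClosed (A i : Set X))
    (i : ι) : X →L[𝕜] A i :=
  ContinuousLinearMap.proj i ∘L ((h.piEquiv hc).symm : X →L[𝕜] ∀ i, A i)

variable (h : DirectSum.IsInternal A) (hc : ∀ i, IsClosed (A i : Set X))

theorem DirectSum.IsInternal.piEquiv_apply (u : ∀ i, A i) :
    h.piEquiv hc u = ∑ i, (u i : X) := by
  simp [DirectSum.IsInternal.piEquiv]

theorem DirectSum.IsInternal.projL_sum (u : ∀ i, A i) (i : ι) :
    h.projL hc i (∑ j, (u j : X)) = u i := by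
  rw [← h.piEquiv_apply hc]
  simp [DirectSum.IsInternal.projL]

theorem DirectSum.IsInternal.sum_projL (x : X) : ∑ i, (h.projL hc i x : X) = x := by
  rw [← h.piEquiv_apply hc]
  exact (h.piEquiv hc).apply_symm_apply x

theorem DirectSum.IsInternal.projL_coe_same {i : ι} (x : A i) : h.projL hc i (x : X) = x := by
  have := h.projL_sum hc (Pi.single i x) i
  rwa [Finset.sum_eq_single i (fun j _ hj => by simp [Pi.single_eq_of_ne hj]) (by simp),
    Pi.single_eq_same] at this

theorem DirectSum.IsInternal.projL_of_mem_ne {i j : ι} (hij : i ≠ j) {x : X} (hx : x ∈ A i) :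
    h.projL hc j x = 0 := by
  have := h.projL_sum hc (Pi.single i ⟨x, hx⟩) j
  rwa [Finset.sum_eq_single i (fun j _ hj => by simp [Pi.single_eq_of_ne hj]) (by simp),
    Pi.single_eq_same, Pi.single_eq_of_ne hij.symm] at this

theorem DirectSum.IsInternal.mem_of_projL_eq_zero {i : ι} {x : X}
    (hx : ∀ j, j ≠ i → h.projL hc j x = 0) : x ∈ A i := by
  rw [← h.sum_projL hc x, Finset.sum_eq_single i (fun j _ hj => by simp [hx j hj]) (by simp)]
  exact (h.projL hc i x).2

theorem DirectSum.IsInternal.ext_projL {x y : X}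
    (hxy : ∀ j, h.projL hc j x = h.projL hc j y) : x = y := by
  rw [← h.sum_projL hc x, ← h.sum_projL hc y]
  exact Finset.sum_congr rfl fun j _ => by rw [hxy]

/-- Turns the partial sums in `IsGeneratedBy` into vanishing of projections, the form in which the
recursion uses them. -/
theorem DirectSum.IsInternal.mem_biSup_iff (p : ι → Prop) (x : X) :
    x ∈ ⨆ (j : ι) (_ : p j), A j ↔ ∀ j, ¬ p j → h.projL hc j x = 0 := by
  constructor
  · intro hx j hj
    have : (⨆ (j : ι) (_ : p j), A j) ≤ LinearMap.ker (h.projL hc j : X →ₗ[𝕜] A j) :=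
      iSup₂_le fun i hi y hy =>
        LinearMap.mem_ker.2 (h.projL_of_mem_ne hc (fun e : i = j => hj (e ▸ hi)) hy)
    exact LinearMap.mem_ker.1 (this hx)
  · intro hx
    rw [← h.sum_projL hc x]
    refine Submodule.sum_mem _ fun j _ => ?_
    by_cases hj : p j
    · exact Submodule.mem_iSup_of_mem j (Submodule.mem_iSup_of_mem hj (h.projL hc j x).2)
    · simp [hx j hj]

end InternalSum

theorem ClosedDirectSums.proj_eq_projL {𝕜 X Y : Type*} [RCLike 𝕜] [NormedAddCommGroup X]
    [NormedSpace 𝕜 X] [NormedAddCommGroup Y] [NormedSpace 𝕜 Y] [CompleteSpace Y] {k : ℕ}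
    (D : ClosedDirectSums 𝕜 X Y k) (i : Fin (k + 1)) (y : Y) :
    D.proj i y = D.internal_R.projL D.isClosed_R i y := by
  let := D.internal_R.chooseDecomposition
  conv_lhs => rw [← D.internal_R.sum_projL D.isClosed_R y]
  simp only [ClosedDirectSums.proj, LinearMap.comp_apply, LinearEquiv.coe_coe,
    DirectSum.decomposeLinearEquiv_apply, map_sum,
    DirectSum.decompose_coe]
  rw [Finset.sum_eq_single i]
  · exact DirectSum.of_eq_same _ _
  · exact fun j _ hj => DirectSum.of_eq_of_ne _ _ _ hj.symm
  · simp

/-! ### Formal products of power series and their asymptotic meaning. -/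

section Convolution

variable {𝕜 X Y : Type*} [RCLike 𝕜] [NormedAddCommGroup X] [NormedSpace 𝕜 X]
  [NormedAddCommGroup Y] [NormedSpace 𝕜 Y]

/-- The coefficient of order `r` of the formal product of `∑ ε ^ a • Λ a` and `∑ ε ^ j • c j`. -/
def convCoeff (Λ : ℕ → X →L[𝕜] Y) (c : ℕ → X) (r : ℕ) : Y :=
  ∑ j ∈ Finset.range (r + 1), Λ (r - j) (c j)

/-- Multiplication of a sequence of coefficients by `ε ^ s`. -/
def shiftCoeff {M : Type*} [Zero M] (s : ℕ) (c : ℕ → M) (j : ℕ) : M := if s ≤ j then c (j - s) else 0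

theorem convCoeff_sub (Λ : ℕ → X →L[𝕜] Y) (c d : ℕ → X) (r : ℕ) :
    convCoeff Λ (c - d) r = convCoeff Λ c r - convCoeff Λ d r := by
  simp [convCoeff]

theorem convCoeff_sum {ι : Type*} (s : Finset ι) (Λ : ℕ → X →L[𝕜] Y) (c : ι → ℕ → X) (r : ℕ) :
    convCoeff Λ (∑ i ∈ s, c i) r = ∑ i ∈ s, convCoeff Λ (c i) r := by
  simp only [convCoeff, Finset.sum_apply, map_sum]
  exact Finset.sum_comm

theorem convCoeff_shift_of_le (Λ : ℕ → X →L[𝕜] Y) (c : ℕ → X) {s r : ℕ} (hsr : s ≤ r) :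
    convCoeff Λ (shiftCoeff s c) r = convCoeff Λ c (r - s) := by
  obtain ⟨t, rfl⟩ := Nat.exists_eq_add_of_le hsr
  rw [convCoeff, add_assoc, Finset.sum_range_add, Nat.add_sub_cancel_left, convCoeff]
  rw [Finset.sum_eq_zero, zero_add]
  · refine Finset.sum_congr rfl fun j _ => ?_
    simp [shiftCoeff, Nat.add_sub_add_left]
  · intro j hj
    simp [shiftCoeff, Nat.not_le.2 (Finset.mem_range.1 hj)]

theorem convCoeff_shift_of_lt (Λ : ℕ → X →L[𝕜] Y) (c : ℕ → X) {s r : ℕ} (hsr : r < s) :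
    convCoeff Λ (shiftCoeff s c) r = 0 := by
  refine Finset.sum_eq_zero fun j hj => ?_
  rw [Finset.mem_range] at hj
  simp [shiftCoeff, show ¬ s ≤ j by omega]

/-- Coefficients are peeled off from below: the limit ε → 0 kills the lowest one, then one divides
by ε. -/
theorem eq_zero_of_sum_pow_smul_isBigO (i : ℕ) (a : ℕ → Y)
    (h : (fun ε : 𝕜 => ∑ r ∈ Finset.range i, ε ^ r • a r) =O[𝓝[≠] 0] fun ε => ε ^ i) :
    ∀ r < i, a r = 0 := by
  induction i generalizing a with
  | zero => simp
  | succ i ih =>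
    have h0 : a 0 = 0 := by
      have hc : ContinuousAt (fun ε : 𝕜 => ∑ r ∈ Finset.range (i + 1), ε ^ r • a r) 0 := by
        fun_prop
      have h1 : Tendsto (fun ε : 𝕜 => ε ^ (i + 1)) (𝓝[≠] 0) (𝓝 0) := by
        have := (continuous_pow (M := 𝕜) (i + 1)).tendsto 0
        rw [zero_pow i.succ_ne_zero] at this
        exact this.mono_left nhdsWithin_le_nhds
      have h2 := tendsto_nhds_unique (hc.tendsto.mono_left nhdsWithin_le_nhds)
        (h.trans_tendsto h1)
      simpa [Finset.sum_range_succ'] using h2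
    have h3 := ih (fun r => a (r + 1)) (by
      obtain ⟨C, hC⟩ := h.bound
      refine Asymptotics.IsBigO.of_bound C ?_
      filter_upwards [hC, self_mem_nhdsWithin] with ε h1 h2
      have h4 : ∑ r ∈ Finset.range (i + 1), ε ^ r • a r
          = ε • ∑ r ∈ Finset.range i, ε ^ r • a (r + 1) := by
        rw [Finset.sum_range_succ', h0, smul_zero, add_zero, Finset.smul_sum]
        exact Finset.sum_congr rfl fun r _ => by rw [smul_smul, pow_succ']
      rw [h4, norm_smul, pow_succ', norm_mul, mul_left_comm] at h1
      exact le_of_mul_le_mul_left h1 (norm_pos_iff.2 h2))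
    intro r hr
    cases r with
    | zero => exact h0
    | succ r => exact h3 r (by omega)

variable {L : 𝕜 → X →L[𝕜] Y} {Λ : ℕ → X →L[𝕜] Y} {k : ℕ}

theorem isBigO_pow_nhds_zero_of_le {p q : ℕ} (hpq : p ≤ q) :
    (fun ε : 𝕜 => ε ^ q) =O[𝓝 0] fun ε => ε ^ p := by
  refine Asymptotics.IsBigO.of_bound 1 ?_
  filter_upwards [Metric.ball_mem_nhds (0 : 𝕜) one_pos] with ε hε
  rw [mem_ball_zero_iff] at hε
  rw [norm_pow, norm_pow, one_mul]
  exact pow_le_pow_of_le_one (norm_nonneg _) hε.le hpq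

theorem isBigO_sub_sum_of_le {q i : ℕ} (hi : i ≤ q) {f : 𝕜 → Y} {a : ℕ → Y}
    (h : (fun ε : 𝕜 => f ε - ∑ j ∈ Finset.range q, ε ^ j • a j) =O[𝓝 0] fun ε => ε ^ q) :
    (fun ε : 𝕜 => f ε - ∑ j ∈ Finset.range i, ε ^ j • a j) =O[𝓝 0] fun ε => ε ^ i := by
  induction q, hi using Nat.le_induction with
  | base => exact h
  | succ q hq ih =>
    refine ih ?_
    have h1 : (fun ε : 𝕜 => ε ^ (q + 1)) =O[𝓝 0] fun ε => ε ^ q :=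
      isBigO_pow_nhds_zero_of_le q.le_succ
    have h2 : (fun ε : 𝕜 => ε ^ q • a q) =O[𝓝 0] fun ε => ε ^ q := by
      refine Asymptotics.IsBigO.of_bound ‖a q‖ (Eventually.of_forall fun ε => ?_)
      rw [norm_smul, mul_comm]
    refine ((h.trans h1).add h2).congr_left fun ε => ?_
    rw [Finset.sum_range_succ]
    abel

/-- Each term ε^j L(ε) c_j needs L only to order i - j. The condition i ≤ n + 1 ensures that the
coefficients below order i do not feel the truncation of the curve after c_n. -/
theorem isBigO_apply_polyCurve_sub
    (hL : (fun ε : 𝕜 => L ε - ∑ j ∈ Finset.range (k + 1), ε ^ j • Λ j) =O[𝓝 0]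
      fun ε => ε ^ (k + 1)) {n i : ℕ} (hin : i ≤ n + 1) (hik : i ≤ k + 1) (c : ℕ → X) :
    (fun ε : 𝕜 => L ε (polyCurve n c ε) - ∑ r ∈ Finset.range i, ε ^ r • convCoeff Λ c r) =O[𝓝 0]
      fun ε => ε ^ i := by
  have h1 : ∀ (x : X) (l : ℕ), l ≤ k + 1 →
      (fun ε : 𝕜 => L ε x - ∑ a ∈ Finset.range l, ε ^ a • Λ a x) =O[𝓝 0] fun ε => ε ^ l := by
    intro x l hl
    refine isBigO_sub_sum_of_le (a := fun a => Λ a x) hl ?_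
    refine Asymptotics.IsBigO.trans ?_ hL
    refine Asymptotics.IsBigO.of_bound ‖x‖ (Eventually.of_forall fun ε => ?_)
    have := (L ε - ∑ j ∈ Finset.range (k + 1), ε ^ j • Λ j).le_opNorm x
    rw [mul_comm]
    simpa using this
  have h2 : (fun ε : 𝕜 => ∑ j ∈ Finset.range (n + 1),
      ε ^ j • (L ε (c j) - ∑ a ∈ Finset.range (i - j), ε ^ a • Λ a (c j))) =O[𝓝 0]
      fun ε => ε ^ i := by
    refine Asymptotics.IsBigO.fun_sum fun j _ => ?_
    have h3 := (Asymptotics.isBigO_refl (fun ε : 𝕜 => ε ^ j) (𝓝 0)).smul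
      (h1 (c j) (i - j) (by omega))
    refine h3.trans ?_
    simp only [smul_eq_mul, ← pow_add]
    exact isBigO_pow_nhds_zero_of_le (by omega)
  refine h2.congr_left fun ε => ?_
  simp only [smul_sub, Finset.sum_sub_distrib, polyCurve, map_sum, map_smul]
  congr 1
  simp only [convCoeff, Finset.smul_sum]
  have h3 := Finset.sum_range_diag_flip i (fun j a => ε ^ (j + a) • Λ a (c j))
  obtain ⟨t, ht⟩ := Nat.exists_eq_add_of_le hin
  rw [ht, Finset.sum_range_add]
  rw [Finset.sum_eq_zero (s := Finset.range t), add_zero]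
  · simp only [smul_smul, ← pow_add]
    rw [← h3]
    refine Finset.sum_congr rfl fun r _ => Finset.sum_congr rfl fun j hj => ?_
    rw [Finset.mem_range] at hj
    rw [show j + (r - j) = r by omega]
  · intro x _
    simp

end Convolution

/-! ### Rank and leading coefficients as linear equations for coefficients. -/

section Characterization

variable {𝕜 X Y : Type*} [RCLike 𝕜] [NormedAddCommGroup X] [NormedSpace 𝕜 X]
  [NormedAddCommGroup Y] [NormedSpace 𝕜 Y] {L : 𝕜 → X →L[𝕜] Y} {Λ : ℕ → X →L[𝕜] Y} {k : ℕ}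

theorem isBigO_pow_iff_coeff_eq_zero {i : ℕ} {f : 𝕜 → Y} {a : ℕ → Y}
    (h : (fun ε : 𝕜 => f ε - ∑ j ∈ Finset.range i, ε ^ j • a j) =O[𝓝 0] fun ε => ε ^ i) :
    f =O[𝓝 0] (fun ε : 𝕜 => ε ^ i) ↔ ∀ r < i, a r = 0 := by
  constructor
  · intro hf
    refine eq_zero_of_sum_pow_smul_isBigO (𝕜 := 𝕜) i a ?_
    exact ((hf.sub h).congr_left fun ε => by abel).mono nhdsWithin_le_nhds
  · intro ha
    refine h.congr_left fun ε => ?_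
    rw [Finset.sum_eq_zero fun j hj => by rw [ha j (Finset.mem_range.1 hj), smul_zero], sub_zero]

theorem isBigO_apply_polyCurve_iff
    (hL : (fun ε : 𝕜 => L ε - ∑ j ∈ Finset.range (k + 1), ε ^ j • Λ j) =O[𝓝 0]
      fun ε => ε ^ (k + 1)) {n i : ℕ} (hin : i ≤ n + 1) (hik : i ≤ k + 1) (c : ℕ → X) :
    (fun ε : 𝕜 => L ε (polyCurve n c ε)) =O[𝓝 0] (fun ε => ε ^ i) ↔
      ∀ r < i, convCoeff Λ c r = 0 :=
  isBigO_pow_iff_coeff_eq_zero (isBigO_apply_polyCurve_sub hL hin hik c)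

theorem isBigO_apply_polyCurve_sub_iff
    (hL : (fun ε : 𝕜 => L ε - ∑ j ∈ Finset.range (k + 1), ε ^ j • Λ j) =O[𝓝 0]
      fun ε => ε ^ (k + 1)) {n i : ℕ} (hin : i ≤ n) (hik : i ≤ k) (c : ℕ → X) (y : Y) :
    (fun ε : 𝕜 => L ε (polyCurve n c ε) - ε ^ i • y) =O[𝓝 0] (fun ε => ε ^ (i + 1)) ↔
      (∀ r < i, convCoeff Λ c r = 0) ∧ convCoeff Λ c i = y := by
  have h := isBigO_apply_polyCurve_sub hL (Nat.succ_le_succ hin) (Nat.succ_le_succ hik) c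
  rw [isBigO_pow_iff_coeff_eq_zero (a := fun r => convCoeff Λ c r - if r = i then y else 0)]
  · constructor
    · intro h0
      refine ⟨fun r hr => ?_, ?_⟩
      · simpa [hr.ne] using h0 r (hr.trans i.lt_succ_self)
      · simpa [sub_eq_zero] using h0 i i.lt_succ_self
    · rintro ⟨h1, h2⟩ r hr
      rcases Nat.lt_succ_iff_lt_or_eq.1 hr with hr | rfl
      · simp [h1 r hr, hr.ne]
      · simp [h2]
  · refine h.congr_left fun ε => ?_
    simp [smul_sub, Finset.sum_sub_distrib]

theorem mem_rootSpace_iff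
    (hL : (fun ε : 𝕜 => L ε - ∑ j ∈ Finset.range (k + 1), ε ^ j • Λ j) =O[𝓝 0]
      fun ε => ε ^ (k + 1)) {i : ℕ} (hik : i ≤ k + 1) (x : X) :
    x ∈ rootSpace L i ↔ ∃ c : ℕ → X, c 0 = x ∧ ∀ r < i, convCoeff Λ c r = 0 :=
  exists_congr fun c => and_congr_right fun _ => isBigO_apply_polyCurve_iff hL i.le_succ hik c

theorem mem_leadSpace_iff
    (hL : (fun ε : 𝕜 => L ε - ∑ j ∈ Finset.range (k + 1), ε ^ j • Λ j) =O[𝓝 0]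
      fun ε => ε ^ (k + 1)) {i : ℕ} (hik : i ≤ k) (y : Y) :
    y ∈ leadSpace L i ↔
      ∃ c : ℕ → X, (∀ r < i, convCoeff Λ c r = 0) ∧ convCoeff Λ c i = y :=
  exists_congr fun c => isBigO_apply_polyCurve_sub_iff hL le_rfl hik c y

theorem opPoly_apply (φ : ℕ → X →L[𝕜] X) (ε : 𝕜) (x : X) :
    opPoly k φ ε x = polyCurve k (fun j => φ j x) ε := by
  simp [opPoly, polyCurve]

end Characterization

/-! ### One step of the recursion for the Jordan polynomial. -/

namespace ClosedDirectSums

variable {𝕜 X Y : Type*} [RCLike 𝕜] [NormedAddCommGroup X] [NormedSpace 𝕜 X]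
  [NormedAddCommGroup Y] [NormedSpace 𝕜 Y] {k : ℕ}

/-- The continuous projection of `X` to `M j`. -/
abbrev projM [CompleteSpace X] (D : ClosedDirectSums 𝕜 X Y k) (j : Fin (k + 2)) : X →L[𝕜] D.M j :=
  D.internal_M.projL D.isClosed_M j

/-- The continuous projection of `Y` to `R j`. -/
abbrev projR [CompleteSpace Y] (D : ClosedDirectSums 𝕜 X Y k) (j : Fin (k + 1)) : Y →L[𝕜] D.R j :=
  D.internal_R.projL D.isClosed_R j

/-- The sum of the `Nc i` with `i + j ≤ t`. -/
def partialSum (D : ClosedDirectSums 𝕜 X Y k) (j t : ℕ) : Submodule 𝕜 X :=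
  ⨆ (i : Fin (k + 1)) (_ : (i : ℕ) + j ≤ t), D.Nc i

theorem partialSum_mono (D : ClosedDirectSums 𝕜 X Y k) {j t j' t' : ℕ} (h : t + j' ≤ t' + j) :
    D.partialSum j t ≤ D.partialSum j' t' :=
  iSup₂_le fun i hi => le_iSup₂_of_le i (by omega) le_rfl

/-- The stages of the recursive construction of the Jordan polynomial. -/
structure IsJordanStage [CompleteSpace X] (D : ClosedDirectSums 𝕜 X Y k) (Λ : ℕ → X →L[𝕜] Y) (i : ℕ)
    (φ : ℕ → X →L[𝕜] X) : Prop where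
  coeff_zero : φ 0 = ContinuousLinearMap.id 𝕜 X
  coeff_mem : ∀ (l : Fin (k + 2)), ∀ x ∈ D.M l, ∀ j, 1 ≤ j → φ j x ∈ D.partialSum j (min l k)
  conv_eq_zero : ∀ x, (∀ j : Fin (k + 2), (j : ℕ) < i → D.projM j x = 0) →
    ∀ r < i, convCoeff Λ (fun j => φ j x) r = 0
  lead : ∀ l : Fin (k + 1), (l : ℕ) < i → ∃ S : D.Nc l ≃L[𝕜] D.R l, ∀ x : D.Nc l,
    (∀ r < (l : ℕ), convCoeff Λ (fun j => φ j (x : X)) r = 0) ∧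
      convCoeff Λ (fun j => φ j (x : X)) l = S x

theorem IsJordanStage.zero [CompleteSpace X] (D : ClosedDirectSums 𝕜 X Y k) (Λ : ℕ → X →L[𝕜] Y) :
    D.IsJordanStage Λ 0 (fun j => if j = 0 then ContinuousLinearMap.id 𝕜 X else 0) where
  coeff_zero := by simp
  coeff_mem := by
    intro l x _ j hj
    simp [Nat.one_le_iff_ne_zero.1 hj]
  conv_eq_zero := by simp
  lead := by simp

/-- The order-i residual of the current chains is cleaned of its parts in R_l, l < i, by subtracting
lower chains multiplied by ε^(i-l). The description of the leading coefficients forces the rest into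
R_i, and the description of the roots makes it an isomorphism on M_i. -/
theorem IsJordanStage.exists_succ [CompleteSpace X] [CompleteSpace Y]
    {D : ClosedDirectSums 𝕜 X Y k} {Λ : ℕ → X →L[𝕜] Y}
    (hroot : ∀ i ≤ k + 1, ∀ x, (∃ c : ℕ → X, c 0 = x ∧ ∀ r < i, convCoeff Λ c r = 0) ↔
      ∀ j : Fin (k + 2), (j : ℕ) < i → D.projM j x = 0)
    (hlead : ∀ i ≤ k, ∀ y,
      (∃ c : ℕ → X, (∀ r < i, convCoeff Λ c r = 0) ∧ convCoeff Λ c i = y) ↔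
      ∀ j : Fin (k + 1), i < (j : ℕ) → D.projR j y = 0)
    {i : ℕ} (hi : i ≤ k) {φ : ℕ → X →L[𝕜] X} (hφ : D.IsJordanStage Λ i φ) :
    ∃ φ', D.IsJordanStage Λ (i + 1) φ' := by
  classical
  -- E l is S_l⁻¹ after the projection to R_l: the chain through E l y has leading term ε^l P_l y.
  -- For l ≥ i it is a dummy 0.
  have hE : ∀ l : Fin (k + 1), ∃ E : Y →L[𝕜] X, (∀ y, E y ∈ D.Nc l) ∧ ((l : ℕ) < i → ∀ y,
      (∀ r < (l : ℕ), convCoeff Λ (fun j => φ j (E y)) r = 0) ∧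
      convCoeff Λ (fun j => φ j (E y)) l = D.projR l y) := by
    intro l
    by_cases hl : (l : ℕ) < i
    · obtain ⟨S, hS⟩ := hφ.lead l hl
      refine ⟨(D.Nc l).subtypeL ∘L (S.symm : D.R l →L[𝕜] D.Nc l) ∘L D.projR l,
        fun y => by simp, fun _ y => ?_⟩
      have := hS (S.symm (D.projR l y))
      simpa using this
    · exact ⟨0, fun y => by simp, fun h => absurd h hl⟩
  choose E hEmem hE using hE
  set A : X →L[𝕜] Y := ∑ j ∈ Finset.range (i + 1), Λ (i - j) ∘L φ j with hA
  have hAx : ∀ x, A x = convCoeff Λ (fun j => φ j x) i := fun x => by simp [hA, convCoeff]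
  -- Projecting to the blocks of index at least i leaves the chains already finished untouched.
  set π : X →L[𝕜] X := ∑ j ∈ Finset.univ.filter (fun j : Fin (k + 2) => i ≤ (j : ℕ)),
    (D.M j).subtypeL ∘L D.projM j with hπ
  have hπ1 : ∀ x, (∀ j : Fin (k + 2), (j : ℕ) < i → D.projM j x = 0) → π x = x := by
    intro x hx
    conv_rhs => rw [← D.internal_M.sum_projL D.isClosed_M x]
    simp only [hπ, sum_apply, ContinuousLinearMap.comp_apply, Submodule.subtypeL_apply]
    refine Finset.sum_subset (Finset.subset_univ _) fun j _ hj => ?_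
    rw [hx j (by simpa using hj)]
    rfl
  have hπ0 : ∀ l : Fin (k + 2), (l : ℕ) < i → ∀ x ∈ D.M l, π x = 0 := by
    intro l hl x hx
    simp only [hπ, sum_apply, ContinuousLinearMap.comp_apply, Submodule.subtypeL_apply]
    refine Finset.sum_eq_zero fun j hj => ?_
    have hlj : l ≠ j := by
      rintro rfl
      exact absurd (Finset.mem_filter.1 hj).2 (by omega)
    rw [D.internal_M.projL_of_mem_ne D.isClosed_M hlj hx]
    rfl
  set I : Finset (Fin (k + 1)) := Finset.univ.filter (fun l : Fin (k + 1) => (l : ℕ) < i) with hI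
  -- The factor ε^(i-l) lifts a leading term of order l to order i, where it cancels P_l A. Since i
  -- - l ≥ 1, the constant coefficient is unchanged.
  set φ' : ℕ → X →L[𝕜] X := fun j =>
    φ j - ∑ l ∈ I, shiftCoeff (i - l) φ j ∘L E l ∘L A ∘L π with hφ'
  have hφ'x : ∀ x, (fun j => φ' j x) = (fun j => φ j x) -
      ∑ l ∈ I, shiftCoeff (i - l) (fun j => φ j (E l (A (π x)))) := by
    intro x
    funext j
    simp only [hφ', sub_apply, sum_apply, ContinuousLinearMap.comp_apply,
      Pi.sub_apply, Finset.sum_apply]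
    congr 1
    refine Finset.sum_congr rfl fun l _ => ?_
    simp only [shiftCoeff]
    split_ifs <;> rfl
  have hzero : φ' 0 = ContinuousLinearMap.id 𝕜 X := by
    rw [← hφ.coeff_zero]
    simp only [hφ', sub_eq_self]
    refine Finset.sum_eq_zero fun l hl => ?_
    have hl : (l : ℕ) < i := (Finset.mem_filter.1 hl).2
    simp [shiftCoeff, show i - (l : ℕ) ≠ 0 by omega]
  -- the residual of the corrected polynomial
  set T : X →L[𝕜] Y := A - ∑ l ∈ I, (D.R l).subtypeL ∘L D.projR l ∘L A with hT
  have hconv : ∀ x, (∀ j : Fin (k + 2), (j : ℕ) < i → D.projM j x = 0) →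
      (∀ r < i, convCoeff Λ (fun j => φ' j x) r = 0) ∧
      convCoeff Λ (fun j => φ' j x) i = T x := by
    intro x hx
    rw [hφ'x, hπ1 x hx]
    constructor
    · intro r hr
      rw [convCoeff_sub, convCoeff_sum, hφ.conv_eq_zero x hx r hr, zero_sub, neg_eq_zero]
      refine Finset.sum_eq_zero fun l hl => ?_
      have hl : (l : ℕ) < i := (Finset.mem_filter.1 hl).2
      rcases lt_or_ge r (i - l) with h | h
      · exact convCoeff_shift_of_lt _ _ h
      · rw [convCoeff_shift_of_le _ _ h]
        exact (hE l hl _).1 _ (by omega)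
    · rw [convCoeff_sub, convCoeff_sum, ← hAx]
      simp only [hT, sub_apply, sum_apply, ContinuousLinearMap.comp_apply,
        Submodule.subtypeL_apply]
      congr 1
      refine Finset.sum_congr rfl fun l hl => ?_
      have hl : (l : ℕ) < i := (Finset.mem_filter.1 hl).2
      rw [convCoeff_shift_of_le _ _ (Nat.sub_le i l), Nat.sub_sub_self hl.le]
      exact (hE l hl _).2
  have hPT : ∀ x, ∀ l : Fin (k + 1), (l : ℕ) < i → D.projR l (T x) = 0 := by
    intro x l hl
    simp only [hT, sub_apply, sum_apply, ContinuousLinearMap.comp_apply,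
        Submodule.subtypeL_apply, map_sub, map_sum]
    rw [Finset.sum_eq_single l, D.internal_R.projL_coe_same, sub_self]
    · exact fun j _ hj => D.internal_R.projL_of_mem_ne D.isClosed_R hj (D.projR j (A x)).2
    · exact fun h => absurd (Finset.mem_filter.2 ⟨Finset.mem_univ l, hl⟩) h
  have hTR : ∀ x, (∀ j : Fin (k + 2), (j : ℕ) < i → D.projM j x = 0) →
      ∀ t : Fin (k + 1), (t : ℕ) = i → T x ∈ D.R t := by
    intro x hx t ht
    refine D.internal_R.mem_of_projL_eq_zero D.isClosed_R fun l hl => ?_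
    rcases lt_or_gt_of_ne (fun h => hl (Fin.ext (h.trans ht.symm)) : (l : ℕ) ≠ i) with h | h
    · exact hPT x l h
    · exact (hlead i hi (T x)).1 ⟨_, hconv x hx⟩ l h
  -- Two curves with the same root differ by ε d. If both have order i, then d has order i - 1 with
  -- leading coefficient in the blocks R_l, l < i. Hence the R_i part of the order-i coefficient
  -- depends on the root alone.
  have hcompare : ∀ x, (∀ j : Fin (k + 2), (j : ℕ) < i → D.projM j x = 0) → ∀ c : ℕ → X, c 0 = x →
      (∀ r < i, convCoeff Λ c r = 0) → ∀ t : Fin (k + 1), (t : ℕ) = i →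
      D.projR t (T x) = D.projR t (convCoeff Λ c i) := by
    intro x hx c hc0 hc p hp
    obtain ⟨h1, h2⟩ := hconv x hx
    set d : ℕ → X := fun j => (c - fun j => φ' j x) (j + 1) with hd
    have hcd : (c - fun j => φ' j x) = shiftCoeff 1 d := by
      funext j
      cases j with
      | zero => simp [shiftCoeff, hc0, hzero]
      | succ j => simp [shiftCoeff, hd]
    have h3 : ∀ r, convCoeff Λ d r = convCoeff Λ c (r + 1) - convCoeff Λ (fun j => φ' j x) (r + 1) := by
      intro r
      rw [← convCoeff_sub, hcd, convCoeff_shift_of_le _ _ (Nat.le_add_left 1 r),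
        Nat.add_sub_cancel]
    rw [eq_comm, ← sub_eq_zero, ← map_sub, ← h2]
    rcases Nat.eq_zero_or_pos i with h0 | h0
    · have : convCoeff Λ c i - convCoeff Λ (fun j => φ' j x) i = 0 := by
        rw [← convCoeff_sub, hcd, convCoeff_shift_of_lt _ _ (by omega)]
      rw [this, map_zero]
    · obtain ⟨t, rfl⟩ := Nat.exists_eq_succ_of_ne_zero h0.ne'
      rw [Nat.succ_eq_add_one, ← h3]
      refine (hlead t (by omega) _).1 ⟨d, fun r hr => ?_, rfl⟩ _ (by omega)
      rw [h3, hc _ (by omega), h1 _ (by omega), sub_zero]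
  have hker : ∀ x, (∀ j : Fin (k + 2), (j : ℕ) < i + 1 → D.projM j x = 0) → T x = 0 := by
    intro x hx
    have hx' : ∀ j : Fin (k + 2), (j : ℕ) < i → D.projM j x = 0 := fun j hj => hx j (by omega)
    obtain ⟨c, hc0, hc⟩ := (hroot (i + 1) (by omega) x).2 hx
    have h1 := hcompare x hx' c hc0 (fun r hr => hc r (by omega))
      ⟨i, by omega⟩ rfl
    rw [hc i (by omega), map_zero,
      D.internal_R.projL_coe_same D.isClosed_R ⟨T x, hTR x hx' ⟨i, by omega⟩ rfl⟩] at h1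
    exact congrArg Subtype.val h1
  have hM : ∀ (l : Fin (k + 2)), ∀ x ∈ D.M l, ∀ t ≤ (l : ℕ),
      ∀ j : Fin (k + 2), (j : ℕ) < t → D.projM j x = 0 := by
    intro l x hx t ht j hj
    refine D.internal_M.projL_of_mem_ne D.isClosed_M ?_ hx
    rintro rfl
    omega
  refine ⟨φ', hzero, ?_, ?_, ?_⟩
  · intro l x hx j hj
    rcases lt_or_ge (l : ℕ) i with hl | hl
    · have : φ' j x = φ j x := by
        simp [hφ', hπ0 l hl x hx]
      rw [this]
      exact hφ.coeff_mem l x hx j hj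
    · have h1 := congrFun (hφ'x x) j
      simp only [Pi.sub_apply, Finset.sum_apply] at h1
      rw [h1]
      refine Submodule.sub_mem _ (hφ.coeff_mem l x hx j hj) (Submodule.sum_mem _ fun t ht => ?_)
      have ht : (t : ℕ) < i := (Finset.mem_filter.1 ht).2
      simp only [shiftCoeff]
      split_ifs with hs
      · rcases Nat.eq_zero_or_pos (j - (i - t)) with h0 | h0
        · rw [h0, hφ.coeff_zero]
          refine Submodule.mem_iSup_of_mem t (Submodule.mem_iSup_of_mem ?_ (hEmem t _))
          have := le_min hl hi
          omega
        -- Here the sharp invariant is needed: on M_t the coefficient of ε^s lands in blocks of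
        -- index at most t - s. The bound k - s required in the end would not survive the shift by i
        -- - t.
        · refine D.partialSum_mono ?_ (hφ.coeff_mem t.castSucc _ (hEmem t _) _ h0)
          have := le_min hl hi
          have h5 := min_le_left ((t.castSucc : Fin (k + 2)) : ℕ) k
          rw [Fin.val_castSucc] at h5
          rw [Fin.val_castSucc]
          omega
      · exact Submodule.zero_mem _
  · intro x hx r hr
    have hx' : ∀ j : Fin (k + 2), (j : ℕ) < i → D.projM j x = 0 := fun j hj => hx j (by omega)
    rcases Nat.lt_succ_iff_lt_or_eq.1 hr with hr | rfl
    · exact (hconv x hx').1 r hr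
    · rw [(hconv x hx').2, hker x hx]
  · intro l hl
    rcases Nat.lt_succ_iff_lt_or_eq.1 hl with hl | hl
    · obtain ⟨S, hS⟩ := hφ.lead l hl
      refine ⟨S, fun x => ?_⟩
      have : (fun j => φ' j (x : X)) = fun j => φ j (x : X) := by
        funext j
        simp [hφ', hπ0 l.castSucc hl x x.2]
      rw [this]
      exact hS x
    · have hMl : ∀ x : D.Nc l, ∀ j : Fin (k + 2), (j : ℕ) < i → D.projM j (x : X) = 0 :=
        fun x => hM l.castSucc x x.2 i hl.ge
      have hTl : ∀ x : D.Nc l, T x ∈ D.R l := fun x => hTR x (hMl x) l hl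
      let S₀ : D.Nc l →L[𝕜] D.R l := (T ∘L (D.Nc l).subtypeL).codRestrict (D.R l) hTl
      have hinj : LinearMap.ker (S₀ : D.Nc l →ₗ[𝕜] D.R l) = ⊥ := by
        refine LinearMap.ker_eq_bot'.2 fun x hx => ?_
        have hTx : T x = 0 := congrArg Subtype.val hx
        obtain ⟨h1, h2⟩ := hconv x (hMl x)
        have h3 := (hroot (i + 1) (by omega) (x : X)).1
          ⟨fun j => φ' j x, by simp [hzero], fun r hr => by
            rcases Nat.lt_succ_iff_lt_or_eq.1 hr with hr | rfl
            · exact h1 r hr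
            · rw [h2, hTx]⟩ l.castSucc (by simp [hl])
        rw [D.internal_M.projL_coe_same D.isClosed_M (i := l.castSucc) x] at h3
        exact h3
      -- A curve with leading coefficient y at order i has a root in the blocks from i on. Its M_i
      -- part suffices, since T kills the blocks above i.
      have hsurj : LinearMap.range (S₀ : D.Nc l →ₗ[𝕜] D.R l) = ⊤ := by
        refine LinearMap.range_eq_top.2 fun y => ?_
        obtain ⟨c, hc, hcy⟩ := (hlead i hi (y : Y)).2 fun j hj =>
          D.internal_R.projL_of_mem_ne D.isClosed_R (by rintro rfl; omega) y.2
        have hx := (hroot i (by omega) (c 0)).1 ⟨c, rfl, hc⟩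
        have h1 := hcompare (c 0) hx c rfl hc l hl
        rw [hcy, D.internal_R.projL_coe_same,
          D.internal_R.projL_coe_same D.isClosed_R (i := l) ⟨T (c 0), hTR _ hx l hl⟩]
          at h1
        refine ⟨D.projM l.castSucc (c 0), ?_⟩
        have h2 : T (c 0 - (D.projM l.castSucc (c 0) : X)) = 0 := by
          refine hker _ fun j hj => ?_
          rw [map_sub]
          by_cases hjl : j = l.castSucc
          · subst hjl
            rw [D.internal_M.projL_coe_same, sub_self]
          · have hj' : (j : ℕ) ≠ i := fun h => hjl (Fin.ext (by simp [h, hl]))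
            rw [hx j (by omega), D.internal_M.projL_of_mem_ne D.isClosed_M (Ne.symm hjl)
              (D.projM l.castSucc (c 0)).2, sub_zero]
        rw [map_sub, sub_eq_zero] at h2
        refine Subtype.ext ?_
        exact h2.symm.trans (congrArg Subtype.val h1)
      have : CompleteSpace (D.Nc l) := (D.isClosed_M _).completeSpace_coe
      have : CompleteSpace (D.R l) := (D.isClosed_R _).completeSpace_coe
      refine ⟨ContinuousLinearEquiv.ofBijective S₀ hinj hsurj, fun x => ?_⟩
      obtain ⟨h1, h2⟩ := hconv x (hMl x)
      rw [hl]
      exact ⟨h1, h2⟩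

end ClosedDirectSums

/-! ### Existence of the Jordan polynomial. -/

section JordanPolynomial

variable {𝕜 X Y : Type*} [RCLike 𝕜] [NormedAddCommGroup X] [NormedSpace 𝕜 X]
  [NormedAddCommGroup Y] [NormedSpace 𝕜 Y] {k : ℕ}

theorem IsApproximation.exists_taylor_derivAlong [CompleteSpace Y] (hk : 1 ≤ k) {m : ℕ∞}
    (hm : 1 ≤ m) {q : ℕ} {U : Set 𝕜} {G : X → Y} {z : 𝕜 → X} {bbar : 𝕜 → Y}
    (h : IsApproximation (m + 2 * k) q U G z bbar) :
    ∃ Λ : ℕ → X →L[𝕜] Y,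
      (fun ε : 𝕜 => derivAlong G z ε - ∑ j ∈ Finset.range (k + 1), ε ^ j • Λ j) =O[𝓝 0]
        fun ε => ε ^ (k + 1) := by
  obtain ⟨ρ, hρ, hρU⟩ := Metric.isOpen_iff.1 h.isOpen 0 h.zero_mem
  refine exists_taylor_isBigO hρ (k + 1) ?_
  -- One derivative is spent on G', and k + 1 on the remainder; k + 2 ≤ m + 2k because m, k ≥ 1.
  have hle : ((k + 1 : ℕ) : ℕ∞) + 1 ≤ m + 2 * k := by
    calc ((k + 1 : ℕ) : ℕ∞) + 1 ≤ 1 + 2 * k := by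
          have : k + 1 + 1 ≤ 1 + 2 * k := by omega
          exact_mod_cast this
      _ ≤ m + 2 * k := by gcongr
  have h1 : ContDiff 𝕜 ((k + 1 : ℕ) : ℕ∞) (fderiv 𝕜 G) :=
    h.contDiff_map.fderiv_right (by exact_mod_cast hle)
  have h2 : ContDiffOn 𝕜 ((k + 1 : ℕ) : ℕ∞) z (Metric.ball 0 ρ) :=
    (h.contDiffOn_curve.mono hρU).of_le (by exact_mod_cast le_self_add.trans hle)
  exact h1.comp_contDiffOn h2

theorem exists_isJordanPolynomial [CompleteSpace X] [CompleteSpace Y]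
    {D : ClosedDirectSums 𝕜 X Y k} {L : 𝕜 → X →L[𝕜] Y} {Λ : ℕ → X →L[𝕜] Y}
    (hL : (fun ε : 𝕜 => L ε - ∑ j ∈ Finset.range (k + 1), ε ^ j • Λ j) =O[𝓝 0]
      fun ε => ε ^ (k + 1)) (hD : D.IsGeneratedBy L) :
    ∃ (S : ∀ i : Fin (k + 1), D.Nc i ≃L[𝕜] D.R i) (φ : ℕ → X →L[𝕜] X),
      IsJordanPolynomial D L S φ := by
  have hroot : ∀ i ≤ k + 1, ∀ x, (∃ c : ℕ → X, c 0 = x ∧ ∀ r < i, convCoeff Λ c r = 0) ↔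
      ∀ j : Fin (k + 2), (j : ℕ) < i → D.projM j x = 0 := by
    intro i hi x
    rw [← mem_rootSpace_iff hL hi, hD.root_eq ⟨i, by omega⟩,
      D.internal_M.mem_biSup_iff D.isClosed_M]
    simp [Fin.lt_def]
  have hlead : ∀ i ≤ k, ∀ y,
      (∃ c : ℕ → X, (∀ r < i, convCoeff Λ c r = 0) ∧ convCoeff Λ c i = y) ↔
      ∀ j : Fin (k + 1), i < (j : ℕ) → D.projR j y = 0 := by
    intro i hi y
    rw [← mem_leadSpace_iff hL hi, hD.lead_eq ⟨i, by omega⟩,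
      D.internal_R.mem_biSup_iff D.isClosed_R]
    simp [Fin.lt_def]
  have hstage : ∀ i ≤ k + 1, ∃ φ, D.IsJordanStage Λ i φ := by
    intro i
    induction i with
    | zero => exact fun _ => ⟨_, ClosedDirectSums.IsJordanStage.zero D Λ⟩
    | succ i ih =>
      intro hi
      obtain ⟨φ, hφ⟩ := ih (by omega)
      exact hφ.exists_succ hroot hlead (by omega)
  obtain ⟨φ, hφ⟩ := hstage (k + 1) le_rfl
  choose S hS using fun l : Fin (k + 1) => hφ.lead l l.2
  refine ⟨S, φ, hφ.coeff_zero, fun j hj hjk x => ?_, fun i x => ?_, fun x => ?_⟩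
  · rw [← D.internal_M.sum_projL D.isClosed_M x, map_sum]
    exact Submodule.sum_mem _ fun l _ => D.partialSum_mono (by omega)
      (hφ.coeff_mem l _ (D.projM l x).2 j hj)
  · simp only [opPoly_apply]
    exact (isBigO_apply_polyCurve_sub_iff hL (Nat.le_of_lt_succ i.2) (Nat.le_of_lt_succ i.2) _ _).2
      (hS i x)
  · simp only [opPoly_apply]
    refine (isBigO_apply_polyCurve_iff hL le_rfl le_rfl _).2 (hφ.conv_eq_zero _ fun j hj => ?_)
    refine D.internal_M.projL_of_mem_ne D.isClosed_M ?_ x.2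
    rintro rfl
    simp at hj

end JordanPolynomial

/-! ### Second order expansion of G along the ansatz. -/

section Expansion

variable {𝕜 X Y : Type*} [RCLike 𝕜] [NormedAddCommGroup X] [NormedSpace 𝕜 X]
  [NormedAddCommGroup Y] [NormedSpace 𝕜 Y] {k : ℕ}

theorem curvatureAtZero_symm {G : X → Y} (hG : ContDiff 𝕜 2 G) (x y : X) :
    curvatureAtZero 𝕜 G x y = curvatureAtZero 𝕜 G y x := by
  have h : IsSymmSndFDerivAt 𝕜 G 0 := hG.contDiffAt.isSymmSndFDerivAt (by simp)
  simp [curvatureAtZero, h.eq x y]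

/-- The second order expansion at a moving base point close to `0`. -/
theorem isLittleO_second_order {G : X → Y} (hG : ContDiff 𝕜 2 G) :
    (fun p : X × X => G (p.1 + p.2) - G p.1 - fderiv 𝕜 G p.1 p.2 - curvatureAtZero 𝕜 G p.2 p.2)
      =o[𝓝 0] fun p => ‖p.2‖ ^ 2 := by
  have hG1 : ContDiff 𝕜 1 (fderiv 𝕜 G) := hG.fderiv_right (by norm_num)
  -- Strict differentiability of G' at 0 compares the two moving points a + t and a, which makes the
  -- estimate uniform in the base point a with G only C².
  have hstrict := (hG1.contDiffAt (x := (0 : X))).hasStrictFDerivAt one_ne_zero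
  refine Asymptotics.isLittleO_iff.2 fun c hc => ?_
  have h1 := (Asymptotics.isLittleO_iff.1 hstrict.isLittleO) hc
  obtain ⟨δ, hδ, hball⟩ := Metric.eventually_nhds_iff_ball.1 h1
  have hmem : Metric.ball (0 : X × X) (δ / 2) ∈ 𝓝 (0 : X × X) :=
    Metric.ball_mem_nhds _ (half_pos hδ)
  filter_upwards [hmem] with p hp
  rw [mem_ball_zero_iff, Prod.norm_def, max_lt_iff] at hp
  obtain ⟨a, h⟩ := p
  simp only at hp ⊢
  let Q : X → Y := fun t => G (a + t) - fderiv 𝕜 G a t - curvatureAtZero 𝕜 G t t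
  have hQ : ∀ t, HasFDerivAt Q (fderiv 𝕜 G (a + t) - fderiv 𝕜 G a -
      fderiv 𝕜 (fderiv 𝕜 G) 0 t) t := by
    intro t
    have e1 : HasFDerivAt (fun t => G (a + t)) (fderiv 𝕜 G (a + t)) t :=
      by
      have h1 := (hG.differentiable (by norm_num) (a + t)).hasFDerivAt.comp t
        ((hasFDerivAt_id t).const_add a)
      simpa using! h1
    have e2 := ((curvatureAtZero 𝕜 G).hasFDerivAt (x := t)).clm_apply (hasFDerivAt_id t)
    refine ((e1.sub (fderiv 𝕜 G a).hasFDerivAt).sub e2).congr_fderiv ?_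
    congr 1
    ext y
    simp only [add_apply, ContinuousLinearMap.comp_apply,
      ContinuousLinearMap.flip_apply, ContinuousLinearMap.id_apply, id]
    rw [curvatureAtZero_symm hG y t, ← two_smul 𝕜]
    simp [curvatureAtZero]
  have hbound : ∀ t ∈ Metric.closedBall (0 : X) ‖h‖, ‖fderiv 𝕜 G (a + t) - fderiv 𝕜 G a -
      fderiv 𝕜 (fderiv 𝕜 G) 0 t‖ ≤ c * ‖h‖ := by
    intro t ht
    rw [mem_closedBall_zero_iff] at ht
    have hat : ((a + t, a) : X × X) ∈ Metric.ball ((0, 0) : X × X) δ := by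
      rw [← Prod.zero_eq_mk, mem_ball_zero_iff, Prod.norm_def, max_lt_iff]
      exact ⟨lt_of_le_of_lt (norm_add_le a t) (by linarith), by linarith⟩
    have := hball _ hat
    simp only [add_sub_cancel_left] at this
    exact this.trans (by gcongr)
  let : NormedSpace ℝ X := NormedSpace.restrictScalars ℝ 𝕜 X
  have hmv := (convex_closedBall (0 : X) ‖h‖).norm_image_sub_le_of_norm_hasFDerivWithin_le
    (fun t _ => (hQ t).hasFDerivWithinAt) hbound (x := 0) (y := h) (by simp) (by simp)
  simp only [Q, add_zero, map_zero, sub_zero] at hmv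
  rw [norm_pow, norm_norm, pow_two, ← mul_assoc]
  refine le_of_eq_of_le ?_ hmv
  congr 1
  abel

/-- The expansion of `G` along the ansatz, to order `2 * k`. -/
theorem isLittleO_ansatz {D : ClosedDirectSums 𝕜 X Y k} (hk : 1 ≤ k)
    {U : Set 𝕜} {G : X → Y} {z : 𝕜 → X} {bbar : 𝕜 → Y}
    {S : ∀ i : Fin (k + 1), D.Nc i ≃L[𝕜] D.R i} {φ : ℕ → X →L[𝕜] X}
    (hU : U ∈ 𝓝 (0 : 𝕜)) (hG : ContDiff 𝕜 2 G) (hz : ContinuousAt z 0) (hz0 : z 0 = 0)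
    (happ : ∀ ε ∈ U, G (z ε) = ε ^ (2 * k) • bbar ε) (hb : ContinuousAt bbar 0)
    (hJ : IsJordanPolynomial D (derivAlong G z) S φ) (n : D.N) (u : ∀ i, D.Nc i) :
    (fun ε : 𝕜 => G (z ε + ε ^ k • opPoly k φ ε
        ((∑ i : Fin (k + 1), ε ^ (k - (i : ℕ)) • (u i : X)) + (n : X))) -
      ε ^ (2 * k) • (bbar 0 + ∑ i, (S i (u i) : Y) +
        curvatureAtZero 𝕜 G ((u (Fin.last k) : X) + n) ((u (Fin.last k) : X) + n)))
      =o[𝓝 0] fun ε => ε ^ (2 * k) := by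
  set w : 𝕜 → X := fun ε => opPoly k φ ε
        ((∑ i : Fin (k + 1), ε ^ (k - (i : ℕ)) • (u i : X)) + (n : X)) with hw
  have hwc : Continuous w := by
    simp only [hw, opPoly]
    fun_prop
  have hw0 : w 0 = (u (Fin.last k) : X) + n := by
    have h1 : ∑ i : Fin (k + 1), (0 : 𝕜) ^ (k - (i : ℕ)) • (u i : X) = u (Fin.last k) := by
      rw [Finset.sum_eq_single (Fin.last k)]
      · simp
      · intro i _ hi
        rw [zero_pow, zero_smul]
        have := Fin.val_lt_last hi
        omega
      · simp
    have h2 : opPoly k φ (0 : 𝕜) = ContinuousLinearMap.id 𝕜 X := by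
      rw [opPoly, Finset.sum_range_succ', Finset.sum_eq_zero (fun j _ => by simp), hJ.coeff_zero]
      simp
    simp only [hw, h1, h2, ContinuousLinearMap.id_apply]
  have hpow : Tendsto (fun ε : 𝕜 => ε ^ k) (𝓝 0) (𝓝 0) := by
    have := (continuous_pow (M := 𝕜) k).tendsto 0
    rwa [zero_pow (by omega)] at this
  have hh0 : Tendsto (fun ε : 𝕜 => ε ^ k • w ε) (𝓝 0) (𝓝 0) := by
    simpa using hpow.smul (hwc.tendsto 0)
  have hpair : Tendsto (fun ε : 𝕜 => (z ε, ε ^ k • w ε)) (𝓝 0) (𝓝 (0 : X × X)) := by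
    have h1 : Tendsto z (𝓝 0) (𝓝 0) := by simpa [ContinuousAt, hz0] using hz
    exact h1.prodMk_nhds hh0
  have hwO : w =O[𝓝 0] (fun _ => (1 : 𝕜)) := (hwc.tendsto 0).isBigO_one 𝕜
  have t1 : (fun ε : 𝕜 => G (z ε + ε ^ k • w ε) - G (z ε) - derivAlong G z ε (ε ^ k • w ε) -
      curvatureAtZero 𝕜 G (ε ^ k • w ε) (ε ^ k • w ε)) =o[𝓝 0] fun ε => ε ^ (2 * k) := by
    refine ((isLittleO_second_order hG).comp_tendsto hpair).trans_isBigO ?_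
    have h1 : (fun ε : 𝕜 => ε ^ k • w ε) =O[𝓝 0] fun ε => ε ^ k := by
      simpa using (Asymptotics.isBigO_refl (fun ε : 𝕜 => ε ^ k) (𝓝 0)).smul hwO
    refine (h1.norm_left.pow 2).congr_right fun ε => ?_
    rw [← pow_mul, mul_comm]
  have small : ∀ {v : 𝕜 → Y}, Tendsto v (𝓝 0) (𝓝 0) →
      (fun ε : 𝕜 => ε ^ (2 * k) • v ε) =o[𝓝 0] fun ε => ε ^ (2 * k) := by
    intro v hv
    simpa using (Asymptotics.isBigO_refl (fun ε : 𝕜 => ε ^ (2 * k)) (𝓝 0)).smul_isLittleO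
      ((Asymptotics.isLittleO_one_iff 𝕜).2 hv)
  have t2 : (fun ε : 𝕜 => G (z ε) - ε ^ (2 * k) • bbar 0) =o[𝓝 0] fun ε => ε ^ (2 * k) := by
    have h1 : Tendsto (fun ε => bbar ε - bbar 0) (𝓝 0) (𝓝 0) := by
      simpa using hb.tendsto.sub_const (bbar 0)
    refine (small h1).congr' ?_ EventuallyEq.rfl
    filter_upwards [hU] with ε hε
    rw [happ ε hε, smul_sub]
  -- The products ε^(k-i) ε^i all equal ε^k, and each chain error becomes O(ε^(k+1)); the outer ε^k
  -- brings the total error to order 2k + 1.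
  have t3 : (fun ε : 𝕜 => derivAlong G z ε (ε ^ k • w ε) - ε ^ (2 * k) • ∑ i, (S i (u i) : Y))
      =o[𝓝 0] fun ε => ε ^ (2 * k) := by
    have h1 : (fun ε : 𝕜 => ε ^ k • ((∑ i : Fin (k + 1), ε ^ (k - (i : ℕ)) •
        (derivAlong G z ε (opPoly k φ ε (u i : X)) - ε ^ (i : ℕ) • (S i (u i) : Y))) +
        derivAlong G z ε (opPoly k φ ε (n : X)))) =O[𝓝 0] fun ε : 𝕜 => ε ^ k • ε ^ (k + 1) := by
      refine (Asymptotics.isBigO_refl _ _).smul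
        ((Asymptotics.IsBigO.fun_sum fun i _ => ?_).add (hJ.null n))
      refine ((Asymptotics.isBigO_refl (fun ε : 𝕜 => ε ^ (k - (i : ℕ))) (𝓝 0)).smul
        (hJ.lead i (u i))).congr_right fun ε => ?_
      rw [smul_eq_mul, ← pow_add]
      congr 1
      have := i.2
      omega
    have h2 : (fun ε : 𝕜 => ε ^ k • ε ^ (k + 1)) =o[𝓝 0] fun ε : 𝕜 => ε ^ (2 * k) := by
      simp only [smul_eq_mul, ← pow_add]
      exact Asymptotics.isLittleO_pow_pow (by omega)
    refine (h1.trans_isLittleO h2).congr_left fun ε => ?_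
    simp only [hw, map_smul, map_add, map_sum, smul_sub, Finset.sum_sub_distrib, smul_add]
    have h3 : ∑ i : Fin (k + 1), ε ^ (k - (i : ℕ)) • ε ^ (i : ℕ) • (S i (u i) : Y) =
        ε ^ k • ∑ i : Fin (k + 1), (S i (u i) : Y) := by
      rw [Finset.smul_sum]
      refine Finset.sum_congr rfl fun i _ => ?_
      rw [smul_smul, ← pow_add, Nat.sub_add_cancel (Nat.le_of_lt_succ i.2)]
    rw [h3, smul_smul, ← pow_add, ← two_mul]
    abel
  have t4 : (fun ε : 𝕜 => curvatureAtZero 𝕜 G (ε ^ k • w ε) (ε ^ k • w ε) -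
      ε ^ (2 * k) • curvatureAtZero 𝕜 G (w 0) (w 0)) =o[𝓝 0] fun ε => ε ^ (2 * k) := by
    have hc : Continuous fun ε => curvatureAtZero 𝕜 G (w ε) (w ε) := by fun_prop
    have h1 : Tendsto (fun ε => curvatureAtZero 𝕜 G (w ε) (w ε) -
        curvatureAtZero 𝕜 G (w 0) (w 0)) (𝓝 0) (𝓝 0) := by
      simpa using (hc.tendsto 0).sub_const (curvatureAtZero 𝕜 G (w 0) (w 0))
    refine (small h1).congr_left fun ε => ?_
    simp only [map_smul, smul_apply, smul_sub, smul_smul, ← pow_add, two_mul]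
  refine (((t1.add t2).add t3).add t4).congr_left fun ε => ?_
  rw [← hw0, smul_add, smul_add]
  abel

end Expansion

/-! ### The reduced equation and its solution. -/

section Core

variable {𝕜 X Y : Type*} [RCLike 𝕜] [NormedAddCommGroup X] [NormedSpace 𝕜 X]
  [NormedAddCommGroup Y] [NormedSpace 𝕜 Y] {k : ℕ}

/-- Division of the ansatz by `ε ^ (2 * k)`. -/
theorem exists_contDiffOn_reduced [CompleteSpace Y] {D : ClosedDirectSums 𝕜 X Y k} (hk : 1 ≤ k)
    {m : ℕ∞} {U : Set 𝕜} {G : X → Y} {z : 𝕜 → X} {bbar : 𝕜 → Y}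
    {S : ∀ i : Fin (k + 1), D.Nc i ≃L[𝕜] D.R i} {φ : ℕ → X →L[𝕜] X}
    (h : IsApproximation (m + 2 * k) (2 * k) U G z bbar)
    (hJ : IsJordanPolynomial D (derivAlong G z) S φ) :
    ∃ ρ : ℝ, 0 < ρ ∧ Metric.ball (0 : 𝕜) ρ ⊆ U ∧
      ∃ g : 𝕜 × (D.N × ∀ i, D.Nc i) → Y,
        ContDiffOn 𝕜 m g (Metric.ball (0 : 𝕜) ρ ×ˢ Set.univ) ∧
        (∀ ε ∈ Metric.ball (0 : 𝕜) ρ, ∀ (n : D.N) u, G (z ε + ε ^ k • opPoly k φ ε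
          ((∑ i : Fin (k + 1), ε ^ (k - (i : ℕ)) • (u i : X)) + (n : X))) =
            ε ^ (2 * k) • g (ε, (n, u))) ∧
        ∀ n u, g (0, (n, u)) = bbar 0 + ∑ i, (S i (u i) : Y) +
          curvatureAtZero 𝕜 G ((u (Fin.last k) : X) + n) ((u (Fin.last k) : X) + n) := by
  obtain ⟨ρ, hρ, hρU⟩ := Metric.isOpen_iff.1 h.isOpen 0 h.zero_mem
  have h2 : (2 : ℕ∞) ≤ m + 2 * k := by
    calc (2 : ℕ∞) ≤ 2 * k := by exact_mod_cast (by omega : 2 ≤ 2 * k)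
      _ ≤ m + 2 * k := le_add_self
  have hG2 : ContDiff 𝕜 2 G := h.contDiff_map.of_le (WithTop.coe_le_coe.2 h2)
  have hz : ContinuousAt z 0 :=
    h.contDiffOn_curve.continuousOn.continuousAt (h.isOpen.mem_nhds h.zero_mem)
  have hexp := fun n u => isLittleO_ansatz hk (h.isOpen.mem_nhds h.zero_mem) hG2 hz h.curve_zero
    h.approx h.continuousAt_remainder hJ n u
  set f : 𝕜 × (D.N × ∀ i, D.Nc i) → Y := fun x => G (z x.1 + x.1 ^ k • opPoly k φ x.1
    ((∑ i : Fin (k + 1), x.1 ^ (k - (i : ℕ)) • (x.2.2 i : X)) + (x.2.1 : X))) with hf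
  have hfc : ContDiffOn 𝕜 (m + (2 * k : ℕ) : ℕ∞) f (Metric.ball (0 : 𝕜) ρ ×ˢ Set.univ) := by
    have hr : ((m + (2 * k : ℕ) : ℕ∞) : WithTop ℕ∞) = ((m + 2 * k : ℕ∞) : WithTop ℕ∞) := by
      push_cast
      rfl
    rw [hr]
    refine h.contDiff_map.comp_contDiffOn (ContDiffOn.add ?_ (ContDiff.contDiffOn ?_))
    · exact (h.contDiffOn_curve.mono hρU).comp contDiffOn_fst fun x hx => hx.1
    · have e1 : ∀ i, ContDiff 𝕜 ((m + 2 * k : ℕ∞) : WithTop ℕ∞)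
          fun x : 𝕜 × (D.N × ∀ i, D.Nc i) => (x.2.2 i : X) := fun i =>
        (D.Nc i).subtypeL.contDiff.comp (contDiff_pi.1 (contDiff_snd.snd : ContDiff 𝕜 _
          fun x : 𝕜 × (D.N × ∀ i, D.Nc i) => x.2.2) i)
      have e2 : ContDiff 𝕜 ((m + 2 * k : ℕ∞) : WithTop ℕ∞)
          fun x : 𝕜 × (D.N × ∀ i, D.Nc i) => (x.2.1 : X) :=
        D.N.subtypeL.contDiff.comp contDiff_snd.fst
      have e3 : ContDiff 𝕜 ((m + 2 * k : ℕ∞) : WithTop ℕ∞)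
          fun x : 𝕜 × (D.N × ∀ i, D.Nc i) => opPoly k φ x.1 := by
        simp only [opPoly]
        exact ContDiff.sum fun j _ => (contDiff_fst.pow j).smul contDiff_const
      exact (contDiff_fst.pow k).smul (e3.clm_apply ((ContDiff.sum fun i _ =>
        (contDiff_fst.pow _).smul (e1 i)).add e2))
  have hfO : ∀ p, (fun ε : 𝕜 => f (ε, p)) =O[𝓝[≠] 0] fun ε => ε ^ (2 * k) := by
    rintro ⟨n, u⟩
    have h1 := (hexp n u).isBigO
    have h2 : ∀ y : Y, (fun ε : 𝕜 => ε ^ (2 * k) • y) =O[𝓝 0] fun ε => ε ^ (2 * k) := fun y =>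
      Asymptotics.IsBigO.of_bound ‖y‖ (Eventually.of_forall fun ε => by rw [norm_smul, mul_comm])
    exact ((h1.add (h2 _)).congr_left fun ε => sub_add_cancel _ _).mono nhdsWithin_le_nhds
  obtain ⟨g, hg, hfg⟩ := exists_contDiffOn_eq_pow_smul hρ (2 * k) hfc hfO
  refine ⟨ρ, hρ, hρU, g, hg, fun ε hε n u => hfg (ε, (n, u)) ⟨hε, trivial⟩, fun n u => ?_⟩
  -- The factorization determines g only for ε ≠ 0; its value at ε = 0 is the limit of the quotient,
  -- read off from the expansion.
  have hgc : Tendsto (fun ε : 𝕜 => g (ε, (n, u))) (𝓝[≠] 0) (𝓝 (g (0, (n, u)))) := by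
    have hc : ContinuousAt g (0, (n, u)) := hg.continuousOn.continuousAt
      ((Metric.isOpen_ball.prod isOpen_univ).mem_nhds ⟨Metric.mem_ball_self hρ, trivial⟩)
    have hc' : ContinuousAt (fun ε : 𝕜 => g (ε, (n, u))) 0 :=
      ContinuousAt.comp (g := g) (f := fun ε : 𝕜 => (ε, (n, u))) hc (by fun_prop)
    exact hc'.tendsto.mono_left nhdsWithin_le_nhds
  refine tendsto_nhds_unique hgc ?_
  rw [tendsto_iff_norm_sub_tendsto_zero]
  have h3 := ((hexp n u).mono (nhdsWithin_le_nhds (s := {0}ᶜ))).norm_left.norm_right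
    |>.tendsto_div_nhds_zero
  refine h3.congr' ?_
  filter_upwards [self_mem_nhdsWithin,
    nhdsWithin_le_nhds (Metric.ball_mem_nhds (0 : 𝕜) hρ)] with ε h1 h2
  have h4 := hfg (ε, (n, u)) ⟨h2, trivial⟩
  simp only [hf] at h4
  rw [h4, ← smul_sub, norm_smul, mul_div_assoc, mul_comm, div_mul_cancel₀]
  exact norm_ne_zero_iff.2 (pow_ne_zero _ h1)

/-- The derivative of the reduced equation is triangular, hence invertible. -/
theorem isInvertible_reduced [CompleteSpace X] [CompleteSpace Y] {D : ClosedDirectSums 𝕜 X Y k}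
    (S : ∀ i : Fin (k + 1), D.Nc i ≃L[𝕜] D.R i) (B : D.Nc (Fin.last k) →L[𝕜] Y)
    (T : D.Nc (Fin.last k) ≃L[𝕜] D.R (Fin.last k))
    (hT : ∀ y, T y = S (Fin.last k) y + D.projR (Fin.last k) (B y)) :
    (∑ i, (D.R i).subtypeL ∘L (S i : D.Nc i →L[𝕜] D.R i) ∘L ContinuousLinearMap.proj i +
      B ∘L ContinuousLinearMap.proj (Fin.last k) :
      (∀ i, D.Nc i) →L[𝕜] Y).IsInvertible := by
  set A : (∀ i, D.Nc i) →L[𝕜] Y :=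
    ∑ i, (D.R i).subtypeL ∘L (S i : D.Nc i →L[𝕜] D.R i) ∘L ContinuousLinearMap.proj i +
      B ∘L ContinuousLinearMap.proj (Fin.last k) with hA
  have hproj : ∀ u i, D.projR i (A u) = S i (u i) + D.projR i (B (u (Fin.last k))) := by
    intro u i
    have := D.internal_R.projL_sum D.isClosed_R (fun i => S i (u i)) i
    simp only [hA, add_apply, sum_apply, ContinuousLinearMap.comp_apply,
      ContinuousLinearMap.proj_apply, Submodule.subtypeL_apply, ContinuousLinearEquiv.coe_coe,
      map_add, this]
  have : ∀ i, CompleteSpace (D.Nc i) := fun i => (D.isClosed_M _).completeSpace_coe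
  have hinj : LinearMap.ker (A : (∀ i, D.Nc i) →ₗ[𝕜] Y) = ⊥ := by
    refine LinearMap.ker_eq_bot'.2 fun u hu => ?_
    have hu' : A u = 0 := hu
    have hlast : u (Fin.last k) = 0 := by
      have h1 := hproj u (Fin.last k)
      rw [hu', map_zero, ← hT] at h1
      exact T.map_eq_zero_iff.1 h1.symm
    funext i
    have h1 := hproj u i
    rw [hu', hlast, map_zero, map_zero, map_zero, add_zero] at h1
    exact (S i).map_eq_zero_iff.1 h1.symm
  have hsurj : LinearMap.range (A : (∀ i, D.Nc i) →ₗ[𝕜] Y) = ⊤ := by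
    refine LinearMap.range_eq_top.2 fun y => ?_
    set x := T.symm (D.projR (Fin.last k) y) with hx
    -- Back substitution: x solves the last component through T, and the others follow. By `hT`, the
    -- same formula at the last index returns x.
    let u : ∀ i, D.Nc i := fun i => (S i).symm (D.projR i y - D.projR i (B x))
    have hux : u (Fin.last k) = x := by
      simp only [u]
      rw [ContinuousLinearEquiv.symm_apply_eq, sub_eq_iff_eq_add, ← hT, hx, T.apply_symm_apply]
    refine ⟨u, D.internal_R.ext_projL D.isClosed_R fun i => ?_⟩
    change D.projR i (A u) = _
    rw [hproj, hux]
    simp [u]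
  exact ⟨ContinuousLinearEquiv.ofBijective A hinj hsurj, rfl⟩

/-- Common core of (i) and (ii): x₀ is a root of the last component at ε = 0, n = 0, and T its
derivative there. The tolerance τ controls both the drift from x₀, used in (i), and the radius δ,
used in (ii). -/
theorem exists_isSolutionMap [CompleteSpace X] [CompleteSpace Y] {D : ClosedDirectSums 𝕜 X Y k}
    (hk : 1 ≤ k) {m : ℕ∞} (hm : 1 ≤ m) {U : Set 𝕜} {G : X → Y} {z : 𝕜 → X} {bbar : 𝕜 → Y}
    {S : ∀ i : Fin (k + 1), D.Nc i ≃L[𝕜] D.R i} {φ : ℕ → X →L[𝕜] X}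
    (h : IsApproximation (m + 2 * k) (2 * k) U G z bbar)
    (hJ : IsJordanPolynomial D (derivAlong G z) S φ) (x₀ : D.Nc (Fin.last k))
    (hx₀ : S (Fin.last k) x₀ + D.projR (Fin.last k) (curvatureAtZero 𝕜 G (x₀ : X) (x₀ : X)) +
      D.projR (Fin.last k) (bbar 0) = 0)
    (T : D.Nc (Fin.last k) ≃L[𝕜] D.R (Fin.last k))
    (hT : ∀ y : D.Nc (Fin.last k), T y = S (Fin.last k) y + D.projR (Fin.last k)
      (curvatureAtZero 𝕜 G (x₀ : X) (y : X) + curvatureAtZero 𝕜 G (y : X) (x₀ : X)))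
    {τ : ℝ} (hτ : 0 < τ) :
    ∃ (ρ δ : ℝ) (nc : 𝕜 × D.N → ∀ i : Fin (k + 1), D.Nc i), 0 < ρ ∧ 0 < δ ∧ δ ≤ τ ∧
      IsSolutionMap D m U G z φ ρ δ nc ∧
      (∀ ε ∈ Metric.ball (0 : 𝕜) ρ, ∀ n ∈ Metric.ball (0 : D.N) δ,
        ‖nc (ε, n) (Fin.last k) - x₀‖ < τ) ∧
      ∀ n ∈ Metric.ball (0 : D.N) δ, ∀ i, S i (nc (0, n) i) + D.projR i
        (curvatureAtZero 𝕜 G ((nc (0, n) (Fin.last k) : X) + n)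
          ((nc (0, n) (Fin.last k) : X) + n)) + D.projR i (bbar 0) = 0 := by
  obtain ⟨ρ₀, hρ₀, hρU, g, hg, hfg, hg0⟩ := exists_contDiffOn_reduced hk h hJ
  have : ∀ i, CompleteSpace (D.Nc i) := fun i => (D.isClosed_M _).completeSpace_coe
  have : CompleteSpace D.N := (D.isClosed_M _).completeSpace_coe
  set B := curvatureAtZero 𝕜 G with hB
  have hproj : ∀ n u i, D.projR i (g (0, (n, u))) = S i (u i) + D.projR i
      (B ((u (Fin.last k) : X) + n) ((u (Fin.last k) : X) + n)) + D.projR i (bbar 0) := by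
    intro n u i
    have h1 := D.internal_R.projL_sum D.isClosed_R (fun i => S i (u i)) i
    rw [hg0, map_add, map_add, h1]
    abel
  -- All components are written as functions of x₀; the equation for x₀ says that the last one is x₀
  -- itself.
  let u₀ : ∀ i, D.Nc i := fun i =>
    -(S i).symm (D.projR i (B (x₀ : X) (x₀ : X)) + D.projR i (bbar 0))
  have hu₀ : u₀ (Fin.last k) = x₀ := by
    simp only [u₀]
    rw [neg_eq_iff_eq_neg, ContinuousLinearEquiv.symm_apply_eq, map_neg, eq_neg_iff_add_eq_zero,
      ← hx₀]
    abel
  let F : (𝕜 × D.N) × (∀ i, D.Nc i) → Y := fun v => g (v.1.1, (v.1.2, v.2))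
  let v₀ : (𝕜 × D.N) × (∀ i, D.Nc i) := ((0, 0), u₀)
  have hF0 : F v₀ = 0 := by
    refine D.internal_R.ext_projL D.isClosed_R fun i => ?_
    change D.projR i (g (0, (0, u₀))) = D.projR i 0
    rw [hproj, hu₀]
    simp [u₀]
  have hFc : ∀ᶠ v in 𝓝 v₀, ContDiffAt 𝕜 m F v := by
    have h1 : ∀ᶠ v in 𝓝 v₀, v.1.1 ∈ Metric.ball (0 : 𝕜) ρ₀ :=
      (continuous_fst.comp continuous_fst).continuousAt.eventually_mem
        (Metric.ball_mem_nhds (0 : 𝕜) hρ₀)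
    filter_upwards [h1] with v hv
    refine ContDiffAt.comp (g := g)
      (f := fun v : (𝕜 × D.N) × (∀ i, D.Nc i) => (v.1.1, (v.1.2, v.2))) v ?_ ?_
    · exact hg.contDiffAt ((Metric.isOpen_ball.prod isOpen_univ).mem_nhds ⟨hv, trivial⟩)
    · exact (contDiff_fst.fst.prodMk (contDiff_fst.snd.prodMk contDiff_snd)).contDiffAt
  have hm0 : (m : WithTop ℕ∞) ≠ 0 := by
    have : m ≠ 0 := fun h0 => by simp [h0] at hm
    exact_mod_cast this
  have hinv : (fderiv 𝕜 F v₀ ∘L .inr 𝕜 (𝕜 × D.N) (∀ i, D.Nc i)).IsInvertible := by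
    have h1 : HasFDerivAt (fun u => F ((0, 0), u))
        (fderiv 𝕜 F v₀ ∘L .inr 𝕜 (𝕜 × D.N) (∀ i, D.Nc i)) u₀ :=
      ((hFc.self_of_nhds.differentiableAt hm0).hasFDerivAt).comp (g := F) u₀
        (hasFDerivAt_prodMk_right (0, 0) u₀)
    let ι : (∀ i, D.Nc i) →L[𝕜] X :=
      (D.Nc (Fin.last k)).subtypeL ∘L ContinuousLinearMap.proj (Fin.last k)
    let Q : D.Nc (Fin.last k) →L[𝕜] Y :=
      (B (x₀ : X) + B.flip (x₀ : X)) ∘L (D.Nc (Fin.last k)).subtypeL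
    have h2 : HasFDerivAt (fun u => F ((0, 0), u))
        (∑ i, (D.R i).subtypeL ∘L (S i : D.Nc i →L[𝕜] D.R i) ∘L ContinuousLinearMap.proj i +
          Q ∘L ContinuousLinearMap.proj (Fin.last k)) u₀ := by
      have e1 := ContinuousLinearMap.hasFDerivAt (x := u₀) (∑ i, (D.R i).subtypeL ∘L
        (S i : D.Nc i →L[𝕜] D.R i) ∘L ContinuousLinearMap.proj i : (∀ i, D.Nc i) →L[𝕜] Y)
      have e2 := (B.hasFDerivAt.comp u₀ (ι.hasFDerivAt (x := u₀))).clm_apply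
        (ι.hasFDerivAt (x := u₀))
      have e3 := (e1.const_add (bbar 0)).add e2
      have e4 : (fun u => F ((0, 0), u)) = fun u => bbar 0 + (∑ i, (D.R i).subtypeL ∘L
          (S i : D.Nc i →L[𝕜] D.R i) ∘L ContinuousLinearMap.proj i :
          (∀ i, D.Nc i) →L[𝕜] Y) u + B (ι u) (ι u) := by
        funext u
        simp only [F, hg0, ι]
        simp
      rw [e4]
      refine e3.congr_fderiv ?_
      congr 1
      ext1 u
      have hι : ι u₀ = x₀ := congrArg Subtype.val hu₀
      simp [Q, hι, ι]
    rw [h1.unique h2]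
    exact isInvertible_reduced S Q T fun y => by rw [hT]; rfl
  obtain ⟨ψ, hψ0, hψc, hψ⟩ := exists_contDiffAt_implicit_eventually hm0 hFc hinv
  have hnear : ∀ᶠ x in 𝓝 v₀.1, ‖ψ x (Fin.last k) - x₀‖ < τ := by
    have hc : ContinuousAt (fun x => ‖ψ x (Fin.last k) - x₀‖) v₀.1 :=
      ((continuous_apply (Fin.last k)).continuousAt.comp hψc).sub continuousAt_const |>.norm
    refine hc.eventually_lt_const ?_
    change ‖ψ v₀.1 (Fin.last k) - x₀‖ < τ
    rw [hψ0]
    simpa [v₀, hu₀] using hτ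
  obtain ⟨r, hr, hball⟩ := Metric.eventually_nhds_iff_ball.1 (hψ.and hnear)
  have hmem : ∀ ε ∈ Metric.ball (0 : 𝕜) (min ρ₀ r), ∀ n ∈ Metric.ball (0 : D.N) (min r τ),
      ((ε, n) : 𝕜 × D.N) ∈ Metric.ball v₀.1 r := by
    intro ε hε n hn
    rw [← ball_prod_same]
    exact ⟨Metric.ball_subset_ball (min_le_right _ _) hε,
      Metric.ball_subset_ball (min_le_left _ _) hn⟩
  refine ⟨min ρ₀ r, min r τ, ψ, lt_min hρ₀ hr, lt_min hr hτ, min_le_right _ _, ⟨?_, ?_, ?_⟩, ?_, ?_⟩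
  · exact (Metric.ball_subset_ball (min_le_left _ _)).trans hρU
  · rintro ⟨ε, n⟩ ⟨hε, hn⟩
    exact (hball _ (hmem ε hε n hn)).1.1.contDiffWithinAt
  · intro ε hε n hn
    rw [hfg ε (Metric.ball_subset_ball (min_le_left _ _) hε) n (ψ (ε, n))]
    have h1 := (hball _ (hmem ε hε n hn)).1.2
    rw [hF0] at h1
    change ε ^ (2 * k) • F ((ε, n), ψ (ε, n)) = 0
    rw [h1, smul_zero]
  · exact fun ε hε n hn => (hball _ (hmem ε hε n hn)).2
  · intro n hn i
    have h1 := (hball _ (hmem 0 (Metric.mem_ball_self (lt_min hρ₀ hr)) n hn)).1.2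
    rw [hF0] at h1
    rw [← hproj]
    change D.projR i (F ((0, n), ψ (0, n))) = 0
    rw [h1, map_zero]

end Core

/-! ### Small roots of the quadratic equation and assembly of the theorem. -/

/-- A quadratic equation with small inhomogeneity has a small regular solution. -/
theorem exists_small_quadratic_solution {𝕜 V W : Type*} [RCLike 𝕜]
    [NormedAddCommGroup V] [NormedSpace 𝕜 V] [CompleteSpace V]
    [NormedAddCommGroup W] [NormedSpace 𝕜 W] (S : V ≃L[𝕜] W) (Q : V →L[𝕜] V →L[𝕜] W)
    {κ : ℝ} (hκ : 0 < κ) :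
    ∃ η : ℝ, 0 < η ∧ ∀ y : W, ‖y‖ < η → ∃ x : V, ‖x‖ < κ ∧ S x + Q x x + y = 0 ∧
      ∃ T : V ≃L[𝕜] W, ∀ v, T v = S v + (Q x v + Q v x) := by
  have hf : HasStrictFDerivAt (fun x => S x + Q x x) (S : V →L[𝕜] W) 0 := by
    have := (S : V →L[𝕜] W).hasStrictFDerivAt (x := 0) |>.add
      ((Q.hasStrictFDerivAt (x := 0)).clm_apply (hasStrictFDerivAt_id 0))
    refine this.congr_fderiv ?_
    ext v
    simp
  have hinv : ∀ᶠ x in 𝓝 (0 : V), ((S : V →L[𝕜] W) + (Q x + Q.flip x)) ∈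
      Set.range ((↑) : (V ≃L[𝕜] W) → V →L[𝕜] W) := by
    have hc : Continuous fun x : V => (S : V →L[𝕜] W) + (Q x + Q.flip x) := by fun_prop
    refine (hc.continuousAt (x := 0)).preimage_mem_nhds ?_
    rw [map_zero, map_zero, add_zero, add_zero]
    exact S.nhds
  have hmap := hf.map_nhds_eq_of_equiv
  -- The strict derivative at 0 is S, so the image of any neighbourhood of 0 is one of 0. The
  -- neighbourhood used keeps x below κ and, invertible operators being open, the derivative
  -- invertible.
  have himage := image_mem_map (m := fun x => S x + Q x x)
    (hinv.and (Metric.ball_mem_nhds (0 : V) hκ))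
  rw [hmap] at himage
  simp only [map_zero, add_zero] at himage
  obtain ⟨η, hη, hball⟩ := Metric.mem_nhds_iff.1 himage
  refine ⟨η, hη, fun y hy => ?_⟩
  obtain ⟨x, ⟨⟨T, hT⟩, hx⟩, hxy⟩ := hball (show -y ∈ Metric.ball 0 η by simpa using hy)
  refine ⟨x, by simpa using hx, ?_, T, fun v => ?_⟩
  · rw [show S x + Q x x = -y from hxy, neg_add_cancel]
  · rw [← ContinuousLinearEquiv.coe_coe, hT]
    simp

theorem firstComponentsFormula_of_eq {𝕜 X Y : Type*} [RCLike 𝕜]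
    [NormedAddCommGroup X] [NormedSpace 𝕜 X] [NormedAddCommGroup Y] [NormedSpace 𝕜 Y]
    [CompleteSpace Y] {k : ℕ} {D : ClosedDirectSums 𝕜 X Y k}
    {S : ∀ i : Fin (k + 1), D.Nc i ≃L[𝕜] D.R i} {B₀ : X →L[𝕜] X →L[𝕜] Y} {b₀ : Y} {n : D.N}
    {v : ∀ i : Fin (k + 1), D.Nc i}
    (h : ∀ i, S i (v i) + D.projR i (B₀ ((v (Fin.last k) : X) + n) ((v (Fin.last k) : X) + n)) +
      D.projR i b₀ = 0) :
    FirstComponentsFormula D S B₀ b₀ n v := by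
  intro i _
  rw [D.proj_eq_projL, D.proj_eq_projL, eq_neg_iff_add_eq_zero]
  apply (S i).injective
  rw [map_add, (S i).apply_symm_apply, map_zero, ← add_assoc]
  exact h i

end

/-- In (i) the operator S' and the form B₀ are quantified before η, and G, z, bbar and the remaining
data after it: this encodes that η depends only on κ, the direct sums, S_{k+1} and B₀. -/
theorem corollary2 {𝕜 X Y : Type*} [RCLike 𝕜]
    [NormedAddCommGroup X] [NormedSpace 𝕜 X] [CompleteSpace X]
    [NormedAddCommGroup Y] [NormedSpace 𝕜 Y] [CompleteSpace Y]
    (k : ℕ) (hk : 1 ≤ k) (D : ClosedDirectSums 𝕜 X Y k) :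
    -- the operators `S₁, …, S_{k+1}` and the polynomial `p_k` exist
    (∀ (m : ℕ∞) (_ : 1 ≤ m) (U : Set 𝕜) (G : X → Y) (z : 𝕜 → X) (bbar : 𝕜 → Y),
      IsApproximation (m + 2 * k) (2 * k) U G z bbar →
      IsKSurjective (derivAlong G z) k →
      D.IsGeneratedBy (derivAlong G z) →
      ∃ (S : ∀ i : Fin (k + 1), D.Nc i ≃L[𝕜] D.R i) (φ : ℕ → X →L[𝕜] X),
        IsJordanPolynomial D (derivAlong G z) S φ) ∧
    -- (i)
    (∀ (S' : D.Nc (Fin.last k) ≃L[𝕜] D.R (Fin.last k)) (B₀ : X →L[𝕜] X →L[𝕜] Y)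
      (κ : ℝ) (_ : 0 < κ), ∃ η : ℝ, 0 < η ∧
      ∀ (m : ℕ∞) (_ : 1 ≤ m) (U : Set 𝕜) (G : X → Y) (z : 𝕜 → X) (bbar : 𝕜 → Y)
        (S : ∀ i : Fin (k + 1), D.Nc i ≃L[𝕜] D.R i) (φ : ℕ → X →L[𝕜] X),
      IsApproximation (m + 2 * k) (2 * k) U G z bbar →
      IsKSurjective (derivAlong G z) k →
      D.IsGeneratedBy (derivAlong G z) →
      IsJordanPolynomial D (derivAlong G z) S φ →
      S (Fin.last k) = S' →
      curvatureAtZero 𝕜 G = B₀ →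
      ‖D.proj (Fin.last k) (bbar 0)‖ < η →
      ∃ (ρ δ : ℝ) (nc : 𝕜 × D.N → ∀ i : Fin (k + 1), D.Nc i), 0 < ρ ∧ 0 < δ ∧
        IsSolutionMap D m U G z φ ρ δ nc ∧
        (∀ ε ∈ Metric.ball (0 : 𝕜) ρ, ∀ n ∈ Metric.ball (0 : D.N) δ,
          ‖nc (ε, n) (Fin.last k)‖ < κ) ∧
        (∀ n ∈ Metric.ball (0 : D.N) δ,
          S (Fin.last k) (nc (0, n) (Fin.last k)) +
            D.proj (Fin.last k) (B₀ ((nc (0, n) (Fin.last k) : X) + n)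
              ((nc (0, n) (Fin.last k) : X) + n)) +
            D.proj (Fin.last k) (bbar 0) = 0) ∧
        (∀ n ∈ Metric.ball (0 : D.N) δ,
          FirstComponentsFormula D S B₀ (bbar 0) n (nc (0, n)))) ∧
    -- (ii)
    (∀ (m : ℕ∞) (_ : 1 ≤ m) (U : Set 𝕜) (G : X → Y) (z : 𝕜 → X) (bbar : 𝕜 → Y)
        (S : ∀ i : Fin (k + 1), D.Nc i ≃L[𝕜] D.R i) (φ : ℕ → X →L[𝕜] X),
      IsApproximation (m + 2 * k) (2 * k) U G z bbar →
      IsKSurjective (derivAlong G z) k →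
      D.IsGeneratedBy (derivAlong G z) →
      IsJordanPolynomial D (derivAlong G z) S φ →
      (∀ x : D.Nc (Fin.last k), curvatureAtZero 𝕜 G (x : X) (x : X) = 0) →
      ∃ (ρ δ : ℝ) (nc : 𝕜 × D.N → ∀ i : Fin (k + 1), D.Nc i), 0 < ρ ∧ 0 < δ ∧
        IsSolutionMap D m U G z φ ρ δ nc ∧
        (∀ n ∈ Metric.ball (0 : D.N) δ,
          ∃ T : D.Nc (Fin.last k) ≃L[𝕜] D.R (Fin.last k),
            (∀ x : D.Nc (Fin.last k), T x = S (Fin.last k) x +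
              (2 : 𝕜) • D.proj (Fin.last k) (curvatureAtZero 𝕜 G (n : X) (x : X))) ∧
            nc (0, n) (Fin.last k) = -T.symm (D.proj (Fin.last k)
              (curvatureAtZero 𝕜 G (n : X) (n : X) + bbar 0))) ∧
        (∀ n ∈ Metric.ball (0 : D.N) δ,
          FirstComponentsFormula D S (curvatureAtZero 𝕜 G) (bbar 0) n (nc (0, n)))) := by
  refine ⟨fun m hm U G z bbar h _ hD => ?_, fun S' B₀ κ hκ => ?_,
    fun m hm U G z bbar S φ h _ _ hJ hquad => ?_⟩
  · obtain ⟨Λ, hΛ⟩ := h.exists_taylor_derivAlong hk hm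
    exact exists_isJordanPolynomial hΛ hD
  · have : CompleteSpace (D.Nc (Fin.last k)) := (D.isClosed_M _).completeSpace_coe
    let ι := (D.Nc (Fin.last k)).subtypeL
    let Q : D.Nc (Fin.last k) →L[𝕜] D.Nc (Fin.last k) →L[𝕜] D.R (Fin.last k) :=
      (ContinuousLinearMap.compL 𝕜 _ _ _ (D.projR (Fin.last k))) ∘L (B₀.bilinearComp ι ι)
    have hQ : ∀ x y : D.Nc (Fin.last k), Q x y = D.projR (Fin.last k) (B₀ (x : X) (y : X)) :=
      fun _ _ => rfl
    -- Half of κ bounds the root x₀, the other half the deviation of the solution map from it.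
    obtain ⟨η, hη, hsolve⟩ := exists_small_quadratic_solution S' Q (half_pos hκ)
    refine ⟨η, hη, fun m hm U G z bbar S φ h _ _ hJ hS hB hb => ?_⟩
    subst hS hB
    rw [D.proj_eq_projL] at hb
    obtain ⟨x₀, hx₀, hx, T, hT⟩ := hsolve _ hb
    obtain ⟨ρ, δ, nc, hρ, hδ, -, hnc, hnear, heq⟩ := exists_isSolutionMap hk hm h hJ x₀
      (by rw [← hQ]; exact hx) T (fun y => by rw [hT, map_add, hQ, hQ]) (half_pos hκ)
    refine ⟨ρ, δ, nc, hρ, hδ, hnc, fun ε hε n hn => ?_, fun n hn => ?_,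
      fun n hn => firstComponentsFormula_of_eq (heq n hn)⟩
    · calc ‖nc (ε, n) (Fin.last k)‖ = ‖(nc (ε, n) (Fin.last k) - x₀) + x₀‖ := by
            rw [sub_add_cancel]
        _ ≤ ‖nc (ε, n) (Fin.last k) - x₀‖ + ‖x₀‖ := norm_add_le _ _
        _ < κ / 2 + κ / 2 := add_lt_add (hnear ε hε n hn) hx₀
        _ = κ := add_halves κ
    · rw [D.proj_eq_projL, D.proj_eq_projL]
      exact heq n hn (Fin.last k)
  · set B := curvatureAtZero 𝕜 G with hB
    have h2 : (2 : ℕ∞) ≤ m + 2 * k := by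
      calc (2 : ℕ∞) ≤ 2 * k := by exact_mod_cast (by omega : 2 ≤ 2 * k)
        _ ≤ m + 2 * k := le_add_self
    have hsymm : ∀ x y, B x y = B y x :=
      curvatureAtZero_symm (h.contDiff_map.of_le (WithTop.coe_le_coe.2 h2))
    -- Polarization: B₀ vanishing on the diagonal removes the correction to the derivative, so T =
    -- S_{k+1} works with an explicit x₀ of any size.
    have hpolar : ∀ x y : D.Nc (Fin.last k), B (x : X) (y : X) + B (y : X) (x : X) = 0 := by
      intro x y
      have h1 := hquad (x + y)
      simpa [hquad x, hquad y] using h1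
    let A : D.N →L[𝕜] D.Nc (Fin.last k) →L[𝕜] D.R (Fin.last k) :=
      (ContinuousLinearMap.compL 𝕜 _ _ _ (D.projR (Fin.last k))) ∘L
        (B.bilinearComp D.N.subtypeL (D.Nc (Fin.last k)).subtypeL)
    have : CompleteSpace (D.Nc (Fin.last k)) := (D.isClosed_M _).completeSpace_coe
    have hinv : ∀ᶠ n in 𝓝 (0 : D.N),
        ((S (Fin.last k) : D.Nc (Fin.last k) →L[𝕜] D.R (Fin.last k)) + (2 : 𝕜) • A n) ∈
          Set.range ((↑) : (D.Nc (Fin.last k) ≃L[𝕜] D.R (Fin.last k)) →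
            D.Nc (Fin.last k) →L[𝕜] D.R (Fin.last k)) := by
      have hc : Continuous fun n : D.N =>
          (S (Fin.last k) : D.Nc (Fin.last k) →L[𝕜] D.R (Fin.last k)) + (2 : 𝕜) • A n := by
        fun_prop
      refine (hc.continuousAt (x := 0)).preimage_mem_nhds ?_
      have h0 : (S (Fin.last k) : D.Nc (Fin.last k) →L[𝕜] D.R (Fin.last k)) + (2 : 𝕜) • A 0 =
          S (Fin.last k) := by
        ext x
        simp
      rw [h0]
      exact (S (Fin.last k)).nhds
    obtain ⟨τ, hτ, hball⟩ := Metric.eventually_nhds_iff_ball.1 hinv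
    obtain ⟨ρ, δ, nc, hρ, hδ, hδτ, hnc, -, heq⟩ := exists_isSolutionMap hk hm h hJ
      (-(S (Fin.last k)).symm (D.projR (Fin.last k) (bbar 0)))
      (by rw [hquad]; simp) (S (Fin.last k)) (fun y => by rw [hpolar]; simp) hτ
    refine ⟨ρ, δ, nc, hρ, hδ, hnc, fun n hn => ?_,
      fun n hn => firstComponentsFormula_of_eq (heq n hn)⟩
    obtain ⟨T, hT⟩ := hball n (Metric.ball_subset_ball hδτ hn)
    have hTx : ∀ x : D.Nc (Fin.last k), T x = S (Fin.last k) x +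
        (2 : 𝕜) • D.projR (Fin.last k) (B (n : X) (x : X)) := by
      intro x
      rw [← ContinuousLinearEquiv.coe_coe, hT]
      rfl
    refine ⟨T, fun x => by rw [D.proj_eq_projL]; exact hTx x, ?_⟩
    have h1 := heq n hn (Fin.last k)
    set x := nc (0, n) (Fin.last k) with hx
    rw [D.proj_eq_projL, eq_neg_iff_add_eq_zero]
    apply T.injective
    rw [map_add, T.apply_symm_apply, hTx, map_zero, ← h1]
    -- Without the square of x, the last equation is linear in x for each fixed n, with operator
    -- S_{k+1} + 2 P B₀ n.
    have h3 : B ((x : X) + n) ((x : X) + n) = (2 : 𝕜) • B (n : X) (x : X) + B (n : X) (n : X) := by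
      simp only [map_add, add_apply]
      rw [hquad x, hsymm (x : X) (n : X), two_smul]
      abel
    rw [h3]
    simp only [map_add, map_smul]
    abel
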